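/- **Setting.** Let $V=\{x_1,\dots,x_n\}$. A $k$-clause is an ordered $k$-tuple of literals over $V$, and a formula $\Phi=(\Phi_1,\dots,\Phi_m)$ is an ordered $m$-tuple of $k$-clauses (repetitions are allowed in both); $\Phi_{ij}$ is the $j$th literal of $\Phi_i$ and $|\Phi_{ij}|$ its underlying variable. For $Z\subset V$, a clause is *$Z$-unique* if exactly one of its $k$ positions holds a positive literal from $V\setminus Z$ and no negative literal in it has its underlying variable in $Z$. A variable $x\in V\setminus Z$ is *$Z$-unsafe* if it occurs positively in a $Z$-unique clause of $\Phi$, and *$Z$-safe* otherwise. Let $\sigma_Z$ be the assignment that sets the variables in $Z$ to false and those in $V\setminus Z$ to true. Let $k_1=\lceil k/2\rceil$. *Phase 1 of Fix* on input $\Phi$: start with $Z=\emptyset$. For $i=1,\dots,m$ in this order: if all literals of $\Phi_i$ are negative and no variable of $\Phi_i$ lies in the current set $Z$, then, if there is $1\le j<k_1$ such that $|\Phi_{ij}|$ is $Z$-safe, add $|\Phi_{ij}|$ to $Z$ for the least such $j$; otherwise add $|\Phi_{i\,k_1}|$ to $Z$. **Proposition 3.1.** For every $0<\varepsilon<0.1$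 there is $k_0=k_0(\varepsilon)$ such that for every $k\ge k_0$ the following holds. Put $\omega=(1-\varepsilon)\ln k$ and $m=\lfloor(1-\varepsilon)2^kk^{-1}\ln(k)\,n\rfloor$, and let $\mathbf\Phi$ be uniformly distributed over the $(2n)^{km}$ formulas with $m$ $k$-clauses over $n$ variables. Then, with probability tending to $1$ as $n\to\infty$ (with $\varepsilon$ and $k$ fixed), the set $Z$ at the end of Phase 1 of Fix on $\mathbf\Phi$ satisfies all of the following: 1. $|Z|\le 4nk^{-1}\ln\omega$. 2. At most $(1+\varepsilon/3)\,\omega n$ of the clauses of $\mathbf\Phi$ are $Z$-unique. 3. At most $\exp(-k^{\varepsilon/8})\,n$ of the clauses of $\mathbf\Phi$ are unsatisfied under $\sigma_Z$. -/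

import Mathlib

open Filter Topology

namespace RandomKSAT

/-- Literals over the variables `x₁, …, xₙ` (indexed by `Fin n`): `(x, true)` is the positive
literal `x`, and `(x, false)` is the negative literal `x̄`. The underlying variable `|l|` is `l.1`. -/
abbrev Literal (n : ℕ) : Type := Fin n × Bool

/-- A `k`-clause is an ordered `k`-tuple of literals, repetitions allowed. -/
abbrev Clause (k n : ℕ) : Type := Fin k → Literal n

/-- A formula is an ordered `m`-tuple of `k`-clauses, repetitions allowed. -/
abbrev Formula (k n m : ℕ) : Type := Fin m → Clause k n

variable {k n m : ℕ}

/-- All literals of the clause are negative. -/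
def AllNegative (C : Clause k n) : Prop := ∀ j, (C j).2 = false

instance (C : Clause k n) : Decidable (AllNegative C) := by
  unfold AllNegative; infer_instance

/-- The clause contains (positively or negatively) a variable from `Z`. -/
def MeetsVars (Z : Finset (Fin n)) (C : Clause k n) : Prop := ∃ j, (C j).1 ∈ Z

instance (Z : Finset (Fin n)) (C : Clause k n) : Decidable (MeetsVars Z C) := by
  unfold MeetsVars; infer_instance

/-- The clause is `Z`-unique: exactly one of its `k` positions holds a positive literal from
`V \ Z`, and no negative literal in it has its underlying variable in `Z`. -/
def ZUnique (Z : Finset (Fin n)) (C : Clause k n) : Prop :=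
  (∃! j, (C j).2 = true ∧ (C j).1 ∉ Z) ∧ ∀ j, (C j).2 = false → (C j).1 ∉ Z

instance (Z : Finset (Fin n)) (C : Clause k n) : Decidable (ZUnique Z C) := by
  unfold ZUnique; unfold ExistsUnique; infer_instance

/-- The variable `x` of `V \ Z` is `Z`-unsafe: it occurs positively in a `Z`-unique clause. -/
def ZUnsafe (Φ : Formula k n m) (Z : Finset (Fin n)) (x : Fin n) : Prop :=
  x ∉ Z ∧ ∃ i, ZUnique Z (Φ i) ∧ ∃ j, Φ i j = (x, true)

instance (Φ : Formula k n m) (Z : Finset (Fin n)) (x : Fin n) : Decidable (ZUnsafe Φ Z x) := by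
  unfold ZUnsafe; infer_instance

/-- The variable `x` of `V \ Z` is `Z`-safe: it is not `Z`-unsafe. -/
def ZSafe (Φ : Formula k n m) (Z : Finset (Fin n)) (x : Fin n) : Prop :=
  x ∉ Z ∧ ¬ ZUnsafe Φ Z x

instance (Φ : Formula k n m) (Z : Finset (Fin n)) (x : Fin n) : Decidable (ZSafe Φ Z x) := by
  unfold ZSafe; infer_instance

/-- `k₁ = ⌈k / 2⌉` (natural-number division rounds down). -/
def k₁ (k : ℕ) : ℕ := (k + 1) / 2

theorem k₁_sub_one_lt (hk : 0 < k) : k₁ k - 1 < k := by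
  unfold k₁; omega

/-- The positions before position `k₁` (counted from `1`, so that `j : Fin k` is the position
`j + 1`) of the `i`-th clause in which the underlying variable is `Z`-safe. -/
def safePositions (Φ : Formula k n m) (Z : Finset (Fin n)) (i : Fin m) : Finset (Fin k) :=
  Finset.univ.filter fun j => (j : ℕ) + 1 < k₁ k ∧ ZSafe Φ Z (Φ i j).1

/-- The body of the loop of Phase 1 for the `i`-th clause, as an update of the current set `Z`:
if the clause is all-negative and contains no variable from `Z`, then the variable in the first
safe position before position `k₁` is added to `Z`, or, if there is no such position, the variable
in position `k₁` (which is the element `k₁ - 1` of `Fin k`). Clauses of length `k = 0` have no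
position; for them nothing is done. -/
def phase1Step (Φ : Formula k n m) (Z : Finset (Fin n)) (i : Fin m) : Finset (Fin n) :=
  if AllNegative (Φ i) ∧ ¬ MeetsVars Z (Φ i) then
    if h : (safePositions Φ Z i).Nonempty then
      insert (Φ i ((safePositions Φ Z i).min' h)).1 Z
    else if hk : 0 < k then
      insert (Φ i ⟨k₁ k - 1, k₁_sub_one_lt hk⟩).1 Z
    else Z
  else Z

/-- The set `Z` at the end of Phase 1: start from `∅` and treat the clauses in order. -/
def phase1 (Φ : Formula k n m) : Finset (Fin n) :=
  (List.finRange m).foldl (phase1Step Φ) ∅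

/-- The assignment `σ_Z`: false on `Z`, true on `V \ Z`. -/
def sigma (Z : Finset (Fin n)) (x : Fin n) : Bool := decide (x ∉ Z)

/-- The clause is satisfied under the assignment `σ`: one of its literals is true. -/
def Satisfies (σ : Fin n → Bool) (C : Clause k n) : Prop := ∃ j, σ (C j).1 = (C j).2

instance (σ : Fin n → Bool) (C : Clause k n) : Decidable (Satisfies σ C) := by
  unfold Satisfies; infer_instance

/-- The number of `Z`-unique clauses of the formula (indices of clauses are counted). -/
def numZUnique (Φ : Formula k n m) (Z : Finset (Fin n)) : ℕ :=
  (Finset.univ.filter fun i => ZUnique Z (Φ i)).card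

/-- The number of clauses of the formula that are not satisfied under `σ`. -/
def numUnsat (Φ : Formula k n m) (σ : Fin n → Bool) : ℕ :=
  (Finset.univ.filter fun i => ¬ Satisfies σ (Φ i)).card

/-- `ω = (1 - ε) ln k`. -/
noncomputable def omega (ε : ℝ) (k : ℕ) : ℝ := (1 - ε) * Real.log k

/-- The number of clauses `m = ⌊(1 - ε) 2ᵏ k⁻¹ ln k · n⌋`. -/
noncomputable def numClauses (ε : ℝ) (k n : ℕ) : ℕ :=
  ⌊(1 - ε) * 2 ^ k * (k : ℝ)⁻¹ * Real.log k * n⌋₊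

/-- The uniform probability measure on the formulas with `m` clauses of length `k` over `n`
variables. -/
noncomputable def uniformFormula (k n m : ℕ) : MeasureTheory.Measure (Formula k n m) :=
  ProbabilityTheory.uniformOn Set.univ

end RandomKSAT

/-! Phase 1 is analysed by resampling. An all-negative clause is never `Z`-unique, so whether a
variable is safe does not depend on the variables of the all-negative clauses. Redrawing those
variables keeps the formula uniform (`expect_resampleClause`) and, with everything else fixed, turns
Phase 1 into a chain on sets `Z` whose `i`-th step uses one fresh uniform tuple (`phase1_resample`).
Exponential potentials then control this chain (`expect_phase1_resample_le`).

Size: once `|Z|` is about `2n ln ω / k`, an all-negative clause misses `Z` with probability about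
`ω⁻²`. As there are about `ωn/k` such clauses, `Z` rarely grows by as much again
(`prob_lt_card_phase1_le`).

Unique clauses: a clause is `Z`-unique with probability at most `k/2ᵏ` for every `Z`. A Chernoff
bound survives the union over all small `Z` (`prob_manyUnique_le`), hence applies to the final one.

Unsatisfied clauses: all-negative clauses end up satisfied. Any other clause with distinct variables
can be falsified only when its unique true variable enters `Z`, so adding a safe variable costs
nothing. Every small `Z` leaves at least `k^(-1+ε/2) n` safe variables (`prob_fewSafe_le`). About
`k/2` independent positions thus all miss them with probability at most `exp(-k^(ε/2)/4)`, and only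
then is an arbitrary variable added (`prob_lt_numMixedUnsat_le`). -/

namespace RandomKSAT

/-! ### Finite uniform averages, product structure and Chernoff bounds. -/

section Expectation

open scoped BigOperators

variable {α β ι : Type*} [Fintype α] [Fintype β] [Fintype ι]

/-- The probability of a set under the uniform distribution on a finite type, as a real number. -/
noncomputable def prob (S : Set α) : ℝ := 𝔼 a, S.indicator (fun _ => (1 : ℝ)) a

theorem prob_le_expect {S : Set α} {F : α → ℝ} (hF : ∀ a, 0 ≤ F a) (hS : ∀ a ∈ S, 1 ≤ F a) :
    prob S ≤ 𝔼 a, F a := by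
  refine Finset.expect_le_expect fun a _ => ?_
  by_cases ha : a ∈ S
  · simpa [ha] using hS a ha
  · simpa [ha] using hF a

theorem prob_nonneg (S : Set α) : 0 ≤ prob S :=
  Finset.expect_nonneg fun a _ => Set.indicator_nonneg (fun _ _ => zero_le_one) a

theorem prob_mono {S T : Set α} (h : S ⊆ T) : prob S ≤ prob T :=
  prob_le_expect (Set.indicator_nonneg fun _ _ => zero_le_one) fun a ha => by simp [h ha]

theorem prob_union_le (S T : Set α) : prob (S ∪ T) ≤ prob S + prob T := by
  unfold prob
  rw [← Finset.expect_add_distrib]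
  refine prob_le_expect (fun a => ?_) fun a ha => ?_
  · exact add_nonneg (Set.indicator_nonneg (fun _ _ => zero_le_one) a)
      (Set.indicator_nonneg (fun _ _ => zero_le_one) a)
  · rcases ha with ha | ha
    · simpa [ha] using Set.indicator_nonneg (fun _ _ => zero_le_one) a
    · simpa [ha] using Set.indicator_nonneg (fun _ _ => zero_le_one) a

theorem prob_exists_le {κ : Type*} (s : Finset κ) (S : κ → Set α) :
    prob {a | ∃ z ∈ s, a ∈ S z} ≤ ∑ z ∈ s, prob (S z) := by
  unfold prob
  rw [← Finset.expect_sum_comm]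
  have h0 : ∀ z a, 0 ≤ (S z).indicator (fun _ => (1 : ℝ)) a := fun z a =>
    Set.indicator_nonneg (fun _ _ => zero_le_one) a
  refine prob_le_expect (fun a => Finset.sum_nonneg fun z _ => h0 z a) fun a ha => ?_
  obtain ⟨z, hz, ha⟩ := ha
  refine le_trans (by simp [ha]) (Finset.single_le_sum (fun z _ => h0 z a) hz)

/-- Markov's inequality. -/
theorem prob_le_expect_div {S : Set α} {F : α → ℝ} {t : ℝ} (ht : 0 < t) (hF : ∀ a, 0 ≤ F a)
    (hS : ∀ a ∈ S, t ≤ F a) : prob S ≤ (𝔼 a, F a) / t := by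
  rw [Finset.expect_div]
  exact prob_le_expect (fun a => div_nonneg (hF a) ht.le) fun a ha => by
    rw [one_le_div ht]; exact hS a ha

theorem prob_compl [Nonempty α] (S : Set α) : prob Sᶜ = 1 - prob S := by
  unfold prob
  rw [eq_sub_iff_add_eq, ← Finset.expect_add_distrib, ← Fintype.expect_one (ι := α) (M := ℝ)]
  refine Finset.expect_congr rfl fun a _ => ?_
  by_cases ha : a ∈ S <;> simp [ha]

theorem expect_pi_prod [DecidableEq ι] (f : ι → β → ℝ) :
    𝔼 y : ι → β, ∏ i, f i (y i) = ∏ i, 𝔼 b, f i b := by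
  simp only [Fintype.expect_eq_sum_div_card, Finset.prod_div_distrib, Finset.prod_univ_sum,
    Fintype.piFinset_univ, Fintype.card_pi, Nat.cast_prod]

theorem expect_fin_cons {m : ℕ} (F : (Fin (m + 1) → β) → ℝ) :
    𝔼 y, F y = 𝔼 b, 𝔼 y : Fin m → β, F (Fin.cons b y) := by
  rw [← Finset.expect_product', Finset.univ_product_univ]
  exact (Fintype.expect_equiv (Fin.consEquiv fun _ => β) _ _ fun _ => rfl).symm

/-- A multiplicative drift bound for an iterated random map. -/
theorem expect_foldl_le {σ : Type*} {m : ℕ} (g : Fin m → σ → β → σ) {a : Fin m → ℝ}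
    (ha : ∀ i, 0 ≤ a i) {W : σ → ℝ} (h : ∀ i s, 𝔼 b, W (g i s b) ≤ a i * W s) (s₀ : σ) :
    𝔼 y : Fin m → β, W ((List.finRange m).foldl (fun s i => g i s (y i)) s₀) ≤
      (∏ i, a i) * W s₀ := by
  induction m generalizing s₀ with
  | zero => simp [Finset.expect_const]
  | succ m ih =>
    rw [expect_fin_cons, Fin.prod_univ_succ]
    simp only [List.finRange_succ, List.foldl_cons, List.foldl_map, Fin.cons_zero, Fin.cons_succ]
    calc _ ≤ 𝔼 b, (∏ i : Fin m, a i.succ) * W (g 0 s₀ b) := by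
          refine Finset.expect_le_expect fun b _ => ?_
          exact ih (fun i => g i.succ) (fun i => ha _) (fun i s => h _ s) _
      _ ≤ _ := by
          rw [← Finset.mul_expect, mul_comm (a 0), mul_assoc]
          exact mul_le_mul_of_nonneg_left (h 0 s₀) (Finset.prod_nonneg fun i _ => ha _)

/-- If `r` preserves the uniform distribution, then so does its coordinatewise application. -/
theorem expect_pi_resample {m : ℕ} {r : α → β → α}
    (hr : ∀ F : α → ℝ, 𝔼 a, 𝔼 b, F (r a b) = 𝔼 a, F a) (F : (Fin m → α) → ℝ) :
    𝔼 x : Fin m → α, 𝔼 y : Fin m → β, F (fun i => r (x i) (y i)) = 𝔼 x, F x := by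
  induction m with
  | zero =>
    simp only [Finset.univ_unique, Finset.expect_singleton]
    exact congrArg F (Subsingleton.elim _ _)
  | succ m ih =>
    have hc : ∀ (a : α) (b : β) (x : Fin m → α) (y : Fin m → β),
        (fun i => r ((Fin.cons a x : Fin (m + 1) → α) i) ((Fin.cons b y : Fin (m + 1) → β) i)) =
          Fin.cons (r a b) fun i => r (x i) (y i) := by
      intro a b x y
      ext i
      refine Fin.cases ?_ (fun i => ?_) i <;> simp
    rw [expect_fin_cons, expect_fin_cons F, ← hr fun a => 𝔼 x : Fin m → α, F (Fin.cons a x)]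
    refine Finset.expect_congr rfl fun a _ => ?_
    simp only [expect_fin_cons (β := β), hc]
    rw [Finset.expect_comm]
    exact Finset.expect_congr rfl fun b _ => ih fun x => F (Fin.cons (r a b) x)

theorem expect_exp_card_le [Nonempty α] {m : ℕ} (P : α → Prop) [DecidablePred P] {p l : ℝ}
    (hp : (𝔼 a, if P a then (1 : ℝ) else 0) ≤ p) (hl : 0 ≤ l) :
    𝔼 x : Fin m → α, Real.exp (l * (Finset.univ.filter fun i => P (x i)).card) ≤
      Real.exp (m * p * (Real.exp l - 1)) := by
  -- The exponential of a count factors over the coordinates, so its mean is a product of means.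
  have h1 : ∀ x : Fin m → α, Real.exp (l * (Finset.univ.filter fun i => P (x i)).card) =
      ∏ i, (1 + (Real.exp l - 1) * if P (x i) then (1 : ℝ) else 0) := by
    intro x
    rw [mul_comm, Real.exp_nat_mul, ← Finset.prod_const, Finset.prod_filter]
    exact Finset.prod_congr rfl fun i _ => by split_ifs <;> simp
  simp only [h1]
  rw [expect_pi_prod fun _ a => (1 + (Real.exp l - 1) * if P a then (1 : ℝ) else 0)]
  rw [Finset.prod_const, Finset.expect_add_distrib, ← Finset.mul_expect, Fintype.expect_const,
    Finset.card_univ, Fintype.card_fin, mul_assoc, Real.exp_nat_mul]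
  have h0 : 0 ≤ Real.exp l - 1 := by linarith [Real.add_one_le_exp l]
  have hE : 0 ≤ 𝔼 a, if P a then (1 : ℝ) else 0 :=
    Finset.expect_nonneg fun a _ => by split_ifs <;> norm_num
  refine pow_le_pow_left₀ (by positivity) ?_ m
  rw [add_comm]
  refine (Real.add_one_le_exp _).trans (Real.exp_le_exp.2 ?_)
  rw [mul_comm]
  exact mul_le_mul_of_nonneg_right hp h0

theorem prob_lt_card_le [Nonempty α] {m : ℕ} (P : α → Prop) [DecidablePred P] {p l : ℝ} (T : ℝ)
    (hp : (𝔼 a, if P a then (1 : ℝ) else 0) ≤ p) (hl : 0 ≤ l) :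
    prob {x : Fin m → α | T < (Finset.univ.filter fun i => P (x i)).card} ≤
      Real.exp (m * p * (Real.exp l - 1) - l * T) := by
  rw [Real.exp_sub]
  refine (prob_le_expect_div (Real.exp_pos (l * T)) (fun x => (Real.exp_pos _).le) ?_).trans
    (div_le_div_of_nonneg_right (expect_exp_card_le P hp hl) (Real.exp_pos _).le)
  intro x hx
  exact Real.exp_le_exp.2 (mul_le_mul_of_nonneg_left (le_of_lt hx) hl)

end Expectation

/-! ### Probabilities of events for a single random clause. -/

section Clauses

open scoped BigOperators

variable {k n m : ℕ}

/-- The variable `x` of `V \ Z` occurs positively in the `Z`-unique clause `C`. -/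
def UniqueAt (Z : Finset (Fin n)) (C : Clause k n) (x : Fin n) : Prop :=
  x ∉ Z ∧ ZUnique Z C ∧ ∃ j, C j = (x, true)

instance (Z : Finset (Fin n)) (C : Clause k n) (x : Fin n) : Decidable (UniqueAt Z C x) := by
  unfold UniqueAt; infer_instance

/-- The literal is false under `σ_Z`. -/
def FalseLit (Z : Finset (Fin n)) (l : Literal n) : Prop := (l.2 = true ↔ l.1 ∈ Z)

instance (Z : Finset (Fin n)) (l : Literal n) : Decidable (FalseLit Z l) := by
  unfold FalseLit; infer_instance

theorem expect_literal (f : Literal n → ℝ) : 𝔼 l, f l = 𝔼 x, (f (x, true) + f (x, false)) / 2 := by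
  rw [← Finset.univ_product_univ, Finset.expect_product]
  refine Finset.expect_congr rfl fun x _ => ?_
  rw [Fintype.expect_eq_sum_div_card]
  simp

theorem expect_falseLit (hn : 0 < n) (Z : Finset (Fin n)) :
    (𝔼 l, if FalseLit Z l then (1 : ℝ) else 0) = 1 / 2 := by
  have : Nonempty (Fin n) := ⟨⟨0, hn⟩⟩
  rw [expect_literal, ← Fintype.expect_const (ι := Fin n) (1 / 2 : ℝ)]
  refine Finset.expect_congr rfl fun x _ => ?_
  by_cases hx : x ∈ Z <;> simp [FalseLit, hx]

theorem expect_literal_eq (x : Fin n) :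
    (𝔼 l : Literal n, if l = (x, true) then (1 : ℝ) else 0) = 1 / 2 * (1 / n) := by
  rw [Fintype.expect_ite_eq']
  simp [NNRat.smul_def, mul_comm]

theorem UniqueAt.exists_falseLit {Z : Finset (Fin n)} {C : Clause k n} {x : Fin n}
    (h : UniqueAt Z C x) :
    ∃ j, C j = (x, true) ∧ ∀ i, i ≠ j → FalseLit Z (C i) := by
  obtain ⟨hx, ⟨⟨j₀, -, hj₀⟩, h2⟩, j, hj⟩ := h
  refine ⟨j, hj, fun i hi => ⟨fun h => ?_, fun h => ?_⟩⟩
  · by_contra h'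
    exact hi ((hj₀ i ⟨h, h'⟩).trans (hj₀ j (by simp [hj, hx])).symm)
  · by_contra h'
    exact h2 i (by simpa using h') h

theorem UniqueAt.eq {Z : Finset (Fin n)} {C : Clause k n} {x x' : Fin n}
    (h : UniqueAt Z C x) (h' : UniqueAt Z C x') : x = x' := by
  obtain ⟨hx, ⟨⟨j₀, -, hj₀⟩, -⟩, j, hj⟩ := h
  obtain ⟨hx', -, j', hj'⟩ := h'
  have h1 := hj₀ j (by simp [hj, hx])
  have h2 := hj₀ j' (by simp [hj', hx'])
  rw [h1] at hj
  rw [h2, hj] at hj'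
  exact (Prod.mk.inj hj').1

/-- Union bound over the position of `x`: that literal is prescribed, with probability `1/(2n)`, and
each of the other `k - 1` is false with probability `1/2` whatever `Z` is. The bound is therefore
uniform in `Z`. -/
theorem expect_uniqueAt_le (hn : 0 < n) (Z : Finset (Fin n)) (x : Fin n) :
    (𝔼 C : Clause k n, if UniqueAt Z C x then (1 : ℝ) else 0) ≤ k / 2 ^ k / n := by
  let f : Fin k → Fin k → Literal n → ℝ := fun j i l =>
    if i = j then (if l = (x, true) then 1 else 0) else if FalseLit Z l then 1 else 0
  have hf : ∀ j i l, 0 ≤ f j i l := by intro j i l; simp only [f]; split_ifs <;> norm_num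
  calc (𝔼 C : Clause k n, if UniqueAt Z C x then (1 : ℝ) else 0)
      ≤ 𝔼 C : Clause k n, ∑ j, ∏ i, f j i (C i) := by
        refine Finset.expect_le_expect fun C _ => ?_
        have h0 : ∀ j, 0 ≤ ∏ i, f j i (C i) := fun j => Finset.prod_nonneg fun i _ => hf j i _
        split_ifs with h
        · obtain ⟨j, hj, hj'⟩ := h.exists_falseLit
          refine le_trans (le_of_eq ?_)
            (Finset.single_le_sum (fun j _ => h0 j) (Finset.mem_univ j))
          refine (Finset.prod_eq_one fun i _ => ?_).symm
          by_cases hi : i = j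
          · subst hi; simp [f, hj]
          · simp [f, hi, hj' i hi]
        · exact Finset.sum_nonneg fun j _ => h0 j
    _ = ∑ j : Fin k, ∏ i, (1 / 2 * if i = j then (1 / n : ℝ) else 1) := by
        rw [Finset.expect_sum_comm]
        refine Finset.sum_congr rfl fun j _ => ?_
        rw [expect_pi_prod]
        refine Finset.prod_congr rfl fun i _ => ?_
        by_cases hi : i = j
        · simp only [f, hi, if_true]; exact expect_literal_eq x
        · simp only [f, hi, if_false, mul_one]; exact expect_falseLit hn Z
    _ = k / 2 ^ k / n := by
        simp only [Finset.prod_mul_distrib, Finset.prod_ite_eq', Finset.mem_univ, if_true]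
        simp
        ring

theorem expect_zUnique_le (hn : 0 < n) (Z : Finset (Fin n)) :
    (𝔼 C : Clause k n, if ZUnique Z C then (1 : ℝ) else 0) ≤ k / 2 ^ k := by
  calc (𝔼 C : Clause k n, if ZUnique Z C then (1 : ℝ) else 0)
      ≤ 𝔼 C : Clause k n, ∑ x ∈ Zᶜ, if UniqueAt Z C x then (1 : ℝ) else 0 := by
        refine Finset.expect_le_expect fun C _ => ?_
        have h0 : ∀ x, (0 : ℝ) ≤ if UniqueAt Z C x then (1 : ℝ) else 0 := fun x => by
          split_ifs <;> norm_num
        split_ifs with h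
        · obtain ⟨j, ⟨h1, h2⟩, -⟩ := h.1
          have : UniqueAt Z C (C j).1 := ⟨h2, h, j, Prod.ext rfl h1⟩
          refine le_trans (by simp [this]) (Finset.single_le_sum (fun x _ => h0 x)
            (Finset.mem_compl.2 h2))
        · exact Finset.sum_nonneg fun x _ => h0 x
    _ ≤ ∑ x ∈ Zᶜ, (k / 2 ^ k / n : ℝ) := by
        rw [Finset.expect_sum_comm]
        exact Finset.sum_le_sum fun x _ => expect_uniqueAt_le hn Z x
    _ ≤ ∑ x : Fin n, (k / 2 ^ k / n : ℝ) :=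
        Finset.sum_le_sum_of_subset_of_nonneg (Finset.subset_univ _) fun _ _ _ => by positivity
    _ = k / 2 ^ k := by
        have : (n : ℝ) ≠ 0 := by positivity
        simp; field_simp

theorem expect_allNegative (hn : 0 < n) :
    (𝔼 C : Clause k n, if AllNegative C then (1 : ℝ) else 0) = 1 / 2 ^ k := by
  have : Nonempty (Fin n) := ⟨⟨0, hn⟩⟩
  have h : ∀ C : Clause k n, (if AllNegative C then (1 : ℝ) else 0) =
      ∏ i, if (C i).2 = false then (1 : ℝ) else 0 := by
    intro C
    rw [Fintype.prod_ite_zero]; simp [AllNegative]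
  simp only [h]
  rw [expect_pi_prod fun _ (l : Literal n) => if l.2 = false then (1 : ℝ) else 0]
  simp [expect_literal]

theorem expect_occurs_le (x : Fin n) :
    (𝔼 C : Clause k n, if ∃ j, C j = (x, true) then (1 : ℝ) else 0) ≤ k / 2 / n := by
  have hn : 0 < n := x.pos
  have : Nonempty (Fin n) := ⟨x⟩
  let f : Fin k → Fin k → Literal n → ℝ := fun j i l =>
    if i = j then (if l = (x, true) then 1 else 0) else 1
  have hf : ∀ j i l, 0 ≤ f j i l := by intro j i l; simp only [f]; split_ifs <;> norm_num
  calc (𝔼 C : Clause k n, if ∃ j, C j = (x, true) then (1 : ℝ) else 0)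
      ≤ 𝔼 C : Clause k n, ∑ j, ∏ i, f j i (C i) := by
        refine Finset.expect_le_expect fun C _ => ?_
        have h0 : ∀ j, 0 ≤ ∏ i, f j i (C i) := fun j => Finset.prod_nonneg fun i _ => hf j i _
        split_ifs with h
        · obtain ⟨j, hj⟩ := h
          refine le_trans (le_of_eq ?_)
            (Finset.single_le_sum (fun j _ => h0 j) (Finset.mem_univ j))
          refine (Finset.prod_eq_one fun i _ => ?_).symm
          by_cases hi : i = j
          · subst hi; simp [f, hj]
          · simp [f, hi]
        · exact Finset.sum_nonneg fun j _ => h0 j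
    _ = ∑ j : Fin k, ∏ i, (if i = j then (1 / 2 * (1 / n) : ℝ) else 1) := by
        rw [Finset.expect_sum_comm]
        refine Finset.sum_congr rfl fun j _ => ?_
        rw [expect_pi_prod]
        refine Finset.prod_congr rfl fun i _ => ?_
        by_cases hi : i = j
        · simp only [f, hi, if_true]; exact expect_literal_eq x
        · simp only [f, hi, if_false]; exact Fintype.expect_const _
    _ = k / 2 / n := by
        simp only [Finset.prod_ite_eq', Finset.mem_univ, if_true]
        simp
        ring

/-- The variables of the clause are pairwise distinct. -/
def DistinctVars (C : Clause k n) : Prop := ∀ i j, (C i).1 = (C j).1 → i = j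

instance (C : Clause k n) : Decidable (DistinctVars C) := by
  unfold DistinctVars; infer_instance

theorem expect_not_distinctVars_le (hn : 0 < n) :
    (𝔼 C : Clause k n, if ¬ DistinctVars C then (1 : ℝ) else 0) ≤ k ^ 2 / n := by
  have : Nonempty (Fin n) := ⟨⟨0, hn⟩⟩
  let f : Fin k × Fin k → Fin n → Fin k → Literal n → ℝ := fun p x i l =>
    if i = p.1 ∨ i = p.2 then (if l.1 = x then 1 else 0) else 1
  have hf : ∀ p x i l, 0 ≤ f p x i l := by
    intro p x i l; simp only [f]; split_ifs <;> norm_num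
  have hx : ∀ x : Fin n, (𝔼 l : Literal n, if l.1 = x then (1 : ℝ) else 0) = 1 / n := by
    intro x
    rw [expect_literal]
    simp [NNRat.smul_def]
  calc (𝔼 C : Clause k n, if ¬ DistinctVars C then (1 : ℝ) else 0)
      -- Union bound over the pair of colliding positions and their common variable.
      ≤ 𝔼 C : Clause k n, ∑ p ∈ Finset.univ.offDiag, ∑ x, ∏ i, f p x i (C i) := by
        refine Finset.expect_le_expect fun C _ => ?_
        have h0 : ∀ p x, 0 ≤ ∏ i, f p x i (C i) := fun p x =>
          Finset.prod_nonneg fun i _ => hf p x i _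
        split_ifs with h
        · exact Finset.sum_nonneg fun p _ => Finset.sum_nonneg fun x _ => h0 p x
        · simp only [DistinctVars, not_forall] at h
          obtain ⟨i, j, hij, hne⟩ := h
          refine le_trans ?_ (Finset.single_le_sum
            (fun p _ => Finset.sum_nonneg fun x _ => h0 p x)
            (show (i, j) ∈ Finset.univ.offDiag by simpa using hne))
          refine le_trans (le_of_eq ?_)
            (Finset.single_le_sum (fun x _ => h0 (i, j) x) (Finset.mem_univ (C i).1))
          refine (Finset.prod_eq_one fun i' _ => ?_).symm
          simp only [f]
          split_ifs with h1 h2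
          · rfl
          · rcases h1 with rfl | rfl
            · exact absurd rfl h2
            · exact absurd hij.symm h2
          · rfl
    _ = ∑ p ∈ (Finset.univ : Finset (Fin k)).offDiag, ∑ _x : Fin n, (1 / n : ℝ) ^ 2 := by
        rw [Finset.expect_sum_comm]
        refine Finset.sum_congr rfl fun p hp => ?_
        rw [Finset.expect_sum_comm]
        refine Finset.sum_congr rfl fun x _ => ?_
        rw [expect_pi_prod]
        have : ∀ i, (𝔼 l, f p x i l) = if i = p.1 ∨ i = p.2 then (1 / n : ℝ) else 1 := by
          intro i
          by_cases hi : i = p.1 ∨ i = p.2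
          · simp only [f, hi, if_true]; exact hx x
          · simp only [f, hi, if_false]; exact Fintype.expect_const _
        simp only [this]
        rw [Finset.prod_ite, Finset.prod_const_one, mul_one, Finset.prod_const, Finset.filter_or,
          Finset.filter_eq', Finset.filter_eq', if_pos (Finset.mem_univ _),
          if_pos (Finset.mem_univ _)]
        congr 1
        exact Finset.card_pair (Finset.mem_offDiag.1 hp).2.2
    _ ≤ k ^ 2 / n := by
        have hn' : (n : ℝ) ≠ 0 := by positivity
        simp only [Finset.sum_const, Finset.offDiag_card, Finset.card_univ, Fintype.card_fin,
          nsmul_eq_mul]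
        have h1 : ((k * k - k : ℕ) : ℝ) ≤ k ^ 2 := by
          rw [sq, ← Nat.cast_mul]; exact Nat.cast_le.2 (Nat.sub_le _ _)
        calc ((k * k - k : ℕ) : ℝ) * (n * (1 / n) ^ 2) = ((k * k - k : ℕ) : ℝ) / n := by
              field_simp
          _ ≤ _ := div_le_div_of_nonneg_right h1 (Nat.cast_nonneg n)

end Clauses

/-! ### Lower tail for empty bins, and the entropy of small sets. -/

section Occupancy

open scoped BigOperators

variable {α β : Type*} [Fintype α] [Nonempty α]

/-- Exponential moment of the number of bins in `E` that receive none of `m` independent balls,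
where a ball falls into at most one bin, and into a given bin with probability at most `p`. -/
theorem expect_pow_card_unhit_le {m : ℕ} (H : α → β → Prop) [∀ a b, Decidable (H a b)]
    {p u : ℝ} (hp₀ : 0 ≤ p) (hp₁ : p ≤ 1) (hu₀ : 0 ≤ u) (hu₁ : u < 1) (E : Finset β)
    (hH : ∀ a, ∀ b ∈ E, ∀ b' ∈ E, H a b → H a b' → b = b')
    (hp : ∀ b ∈ E, (𝔼 a, if H a b then (1 : ℝ) else 0) ≤ p) :
    𝔼 x : Fin m → α, (1 - u) ^ (E.filter fun b => ∀ i, ¬ H (x i) b).card ≤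
      (1 - u * (1 - p) ^ m) ^ E.card := by
  induction m generalizing E with
  | zero => simp
  | succ m ih =>
    have hq₀ : 0 ≤ (1 - p) ^ m := pow_nonneg (by linarith) m
    have hq₁ : (1 - p) ^ m ≤ 1 := pow_le_one₀ (by linarith) (by linarith)
    -- After the first ball, the remaining `m` balls act on each surviving bin as if `u` were
    -- discounted to `w`.
    set w := u * (1 - p) ^ m with hw
    have hw₀ : 0 ≤ w := mul_nonneg hu₀ hq₀
    have hw₁ : w < 1 := by nlinarith
    have hv : 0 < 1 - w := by linarith
    have hv' : 0 ≤ (1 - w)⁻¹ - 1 := by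
      rw [sub_nonneg]; exact (one_le_inv₀ hv).2 (by linarith)
    rw [expect_fin_cons]
    calc _ ≤ 𝔼 a, (1 - w) ^ (E.filter fun b => ¬ H a b).card := by
          refine Finset.expect_le_expect fun a _ => ?_
          refine le_trans (le_of_eq ?_) (ih (E.filter fun b => ¬ H a b)
            (fun a b hb b' hb' => hH a b (Finset.mem_filter.1 hb).1 b' (Finset.mem_filter.1 hb').1)
            fun b hb => hp b (Finset.mem_filter.1 hb).1)
          refine Finset.expect_congr rfl fun x _ => ?_
          rw [Finset.filter_filter]
          simp only [Fin.forall_fin_succ, Fin.cons_zero, Fin.cons_succ]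
      -- The first ball removes at most one bin, so the power is affine in the indicator of a hit.
      -- No independence between bins is needed.
      _ ≤ 𝔼 a, (1 - w) ^ E.card * (1 + ((1 - w)⁻¹ - 1) * ∑ b ∈ E, if H a b then (1 : ℝ) else 0) := by
          refine Finset.expect_le_expect fun a _ => ?_
          have hc : (E.filter fun b => H a b).card ≤ 1 := Finset.card_le_one.2 fun b hb b' hb' =>
            hH a b (Finset.mem_filter.1 hb).1 b' (Finset.mem_filter.1 hb').1
              (Finset.mem_filter.1 hb).2 (Finset.mem_filter.1 hb').2
          have hs := Finset.card_filter_add_card_filter_not (s := E) (fun b => H a b)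
          rw [← Finset.sum_filter, Finset.sum_const, nsmul_eq_mul, mul_one, ← hs]
          rcases Nat.le_one_iff_eq_zero_or_eq_one.1 hc with h | h
          · rw [h]; simp
          · rw [h, pow_add]; apply le_of_eq; push_cast; field_simp; ring
      _ ≤ (1 - w) ^ E.card * (1 + E.card * (((1 - w)⁻¹ - 1) * p)) := by
          rw [← Finset.mul_expect, Finset.expect_add_distrib, Fintype.expect_const,
            ← Finset.mul_expect, Finset.expect_sum_comm]
          refine mul_le_mul_of_nonneg_left ((add_le_add_iff_left _).2 ?_) (by positivity)
          rw [mul_left_comm]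
          refine mul_le_mul_of_nonneg_left ?_ hv'
          refine (Finset.sum_le_sum hp).trans ?_
          simp [mul_comm]
      -- Bernoulli's inequality restores a pure power, whose base is `1 - w(1 - p)`.
      _ ≤ (1 - w) ^ E.card * (1 + ((1 - w)⁻¹ - 1) * p) ^ E.card := by
          gcongr
          exact one_add_mul_le_pow (by nlinarith [mul_nonneg hv' hp₀]) _
      _ = (1 - u * (1 - p) ^ (m + 1)) ^ E.card := by
          rw [← mul_pow]
          congr 1
          rw [pow_succ, ← mul_assoc, ← hw]
          field_simp
          ring

theorem prob_card_unhit_lt_le {m : ℕ} (H : α → β → Prop) [∀ a b, Decidable (H a b)]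
    {p : ℝ} (hp₀ : 0 ≤ p) (hp₁ : p ≤ 1) (E : Finset β)
    (hH : ∀ a, ∀ b ∈ E, ∀ b' ∈ E, H a b → H a b' → b = b')
    (hp : ∀ b ∈ E, (𝔼 a, if H a b then (1 : ℝ) else 0) ≤ p) (s : ℝ) :
    prob {x : Fin m → α | ((E.filter fun b => ∀ i, ¬ H (x i) b).card : ℝ) < s} ≤
      Real.exp (s - (1 - p) ^ m * E.card / 2) := by
  have h1 := expect_pow_card_unhit_le (m := m) H hp₀ hp₁ (u := 1 / 2) (by norm_num) (by norm_num)
    E hH hp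
  have h2 : (1 - 1 / 2 * (1 - p) ^ m) ^ E.card ≤ Real.exp (-((1 - p) ^ m * E.card / 2)) := by
    have hq₁ : (1 - p) ^ m ≤ 1 := pow_le_one₀ (by linarith) (by linarith)
    calc _ ≤ (Real.exp (-((1 - p) ^ m / 2))) ^ E.card := by
          refine pow_le_pow_left₀ (by linarith) ?_ _
          linarith [Real.add_one_le_exp (-((1 - p) ^ m / 2))]
      _ = _ := by rw [← Real.exp_nat_mul]; ring_nf
  calc _ ≤ (𝔼 x : Fin m → α, (1 - 1 / 2 : ℝ) ^ (E.filter fun b => ∀ i, ¬ H (x i) b).card) /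
        Real.exp (-s) := by
        refine prob_le_expect_div (Real.exp_pos _) (fun x => by positivity) fun x hx => ?_
        have hx : ((E.filter fun b => ∀ i, ¬ H (x i) b).card : ℝ) < s := hx
        set c := (E.filter fun b => ∀ i, ¬ H (x i) b).card
        calc Real.exp (-s) ≤ Real.exp (c * (-1)) := Real.exp_le_exp.2 (by linarith)
          _ = Real.exp (-1) ^ c := Real.exp_nat_mul _ _
          _ ≤ _ := by
            refine pow_le_pow_left₀ (Real.exp_pos _).le ?_ _
            rw [Real.exp_neg]
            rw [inv_le_comm₀ (Real.exp_pos _) (by norm_num)]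
            linarith [Real.add_one_le_exp (1 : ℝ)]
    _ ≤ Real.exp (-((1 - p) ^ m * E.card / 2)) / Real.exp (-s) :=
        div_le_div_of_nonneg_right (h1.trans h2) (Real.exp_pos _).le
    _ = _ := by rw [← Real.exp_sub]; ring_nf

/-- Give `Z` the weight `y^|Z|`. The total weight is `(1 + y)ⁿ ≤ exp(ny)`, and each counted set
weighs at least `y^t`. -/
theorem card_filter_card_le {n : ℕ} (t : ℝ) {y : ℝ} (hy₀ : 0 < y) (hy₁ : y ≤ 1) :
    (((Finset.univ : Finset (Finset (Fin n))).filter fun Z => (Z.card : ℝ) ≤ t).card : ℝ) ≤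
      Real.exp (n * y - t * Real.log y) := by
  have hly : Real.log y ≤ 0 := Real.log_nonpos hy₀.le hy₁
  calc _ = ∑ Z ∈ (Finset.univ : Finset (Finset (Fin n))).filter fun Z => (Z.card : ℝ) ≤ t,
        (1 : ℝ) := by simp
    _ ≤ ∑ Z : Finset (Fin n), Real.exp (-(t * Real.log y)) * (y ^ Z.card * 1 ^ (n - Z.card)) := by
        rw [Finset.sum_filter]
        refine Finset.sum_le_sum fun Z _ => ?_
        split_ifs with h
        · have : y ^ Z.card = Real.exp (Z.card * Real.log y) := by
            rw [Real.exp_nat_mul, Real.exp_log hy₀]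
          rw [one_pow, mul_one, this, ← Real.exp_add]
          apply Real.one_le_exp
          nlinarith
        · positivity
    _ = Real.exp (-(t * Real.log y)) * (y + 1) ^ n := by
        rw [← Finset.mul_sum]
        have := Fintype.sum_pow_mul_eq_add_pow (Fin n) y 1
        rw [Fintype.card_fin] at this
        rw [this]
    _ ≤ Real.exp (-(t * Real.log y)) * Real.exp (n * y) := by
        gcongr
        rw [Real.exp_nat_mul]
        exact pow_le_pow_left₀ (by linarith) (Real.add_one_le_exp y) n
    _ = _ := by rw [← Real.exp_add]; ring_nf

end Occupancy

/-! ### Redrawing the variables of all-negative clauses. -/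

section Resampling

open scoped BigOperators

variable {k n m : ℕ}

/-- Replace the variables of an all-negative clause by `v`, and keep any other clause. -/
def resampleClause (C : Clause k n) (v : Fin k → Fin n) : Clause k n :=
  if AllNegative C then fun j => (v j, false) else C

/-- Replace the variables of the all-negative clauses of a formula by those given by `y`. -/
def resample (Φ : Formula k n m) (y : Fin m → Fin k → Fin n) : Formula k n m :=
  fun i => resampleClause (Φ i) (y i)

/-- Signs and variables of a uniform clause are independent. For a fixed sign pattern either all
variables are replaced by fresh uniform ones or nothing changes. -/
theorem expect_resampleClause (hn : 0 < n) (F : Clause k n → ℝ) :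
    𝔼 C, 𝔼 v, F (resampleClause C v) = 𝔼 C, F C := by
  have : Nonempty (Fin n) := ⟨⟨0, hn⟩⟩
  have h : ∀ G : Clause k n → ℝ, 𝔼 C, G C =
      𝔼 s : Fin k → Bool, 𝔼 v : Fin k → Fin n, G fun j => (v j, s j) := by
    intro G
    rw [Finset.expect_comm, ← Finset.expect_product', Finset.univ_product_univ]
    exact Fintype.expect_equiv (Equiv.arrowProdEquivProdArrow _ _ _) _ _ fun _ => rfl
  rw [h, h F]
  refine Finset.expect_congr rfl fun s _ => ?_
  by_cases hs : ∀ j, s j = false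
  · simp only [resampleClause, AllNegative, hs, implies_true, if_true]
    exact Fintype.expect_const _
  · simp only [resampleClause, AllNegative, hs, if_false]
    exact Finset.expect_congr rfl fun v _ => Fintype.expect_const _

/-- This plays the role of conditioning: the probability of `B` is the average over `Φ` of its
resampled probability, which is at most `r` on `G` and at most `1` elsewhere. -/
theorem prob_le_of_resample (hn : 0 < n) {G B : Set (Formula k n m)} {r : ℝ} (hr : 0 ≤ r)
    (h : ∀ Φ ∈ G, prob {y | resample Φ y ∈ B} ≤ r) : prob B ≤ prob Gᶜ + r := by
  have : Nonempty (Fin n) := ⟨⟨0, hn⟩⟩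
  unfold prob at *
  rw [← expect_pi_resample (expect_resampleClause hn) (B.indicator _)]
  rw [← Fintype.expect_const (ι := Formula k n m) r, ← Finset.expect_add_distrib]
  refine Finset.expect_le_expect fun Φ _ => ?_
  by_cases hΦ : Φ ∈ G
  · have h1 : 𝔼 y : Fin m → Fin k → Fin n, B.indicator (fun _ => (1 : ℝ))
        (fun i => resampleClause (Φ i) (y i)) ≤ r := h Φ hΦ
    simpa [hΦ] using h1
  · have : 𝔼 y : Fin m → Fin k → Fin n, B.indicator (fun _ => (1 : ℝ))
        (fun i => resampleClause (Φ i) (y i)) ≤ 1 := by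
      refine Finset.expect_le Finset.univ_nonempty fun y _ => ?_
      exact Set.indicator_le_self' (fun _ _ => zero_le_one) _
    simp only [Set.indicator_of_mem (Set.mem_compl hΦ)]
    linarith

theorem allNegative_resampleClause {C : Clause k n} {v : Fin k → Fin n} :
    AllNegative (resampleClause C v) ↔ AllNegative C := by
  unfold resampleClause
  split_ifs with h
  · simp [h]; simp [AllNegative]
  · rfl

theorem AllNegative.not_zUnique {C : Clause k n} (h : AllNegative C) (Z : Finset (Fin n)) :
    ¬ ZUnique Z C := by
  rintro ⟨⟨j, hj, -⟩, -⟩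
  simp [h j] at hj

theorem uniqueAt_resampleClause {C : Clause k n} {v : Fin k → Fin n} {Z : Finset (Fin n)}
    {x : Fin n} : UniqueAt Z (resampleClause C v) x ↔ UniqueAt Z C x := by
  by_cases h : AllNegative C
  · exact iff_of_false (fun h' => (allNegative_resampleClause.2 h).not_zUnique Z h'.2.1)
      (fun h' => h.not_zUnique Z h'.2.1)
  · simp [resampleClause, h]

theorem zSafe_iff {Φ : Formula k n m} {Z : Finset (Fin n)} {x : Fin n} :
    ZSafe Φ Z x ↔ x ∉ Z ∧ ∀ i, ¬ UniqueAt Z (Φ i) x := by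
  simp only [ZSafe, ZUnsafe, UniqueAt]
  refine and_congr_right fun hx => ?_
  simp [hx]

theorem zSafe_resample {Φ : Formula k n m} {y : Fin m → Fin k → Fin n} {Z : Finset (Fin n)}
    {x : Fin n} : ZSafe (resample Φ y) Z x ↔ ZSafe Φ Z x := by
  simp only [zSafe_iff, resample, uniqueAt_resampleClause]

theorem phase1Step_congr {Φ Ψ : Formula k n m} {Z : Finset (Fin n)} {i : Fin m} (hi : Φ i = Ψ i)
    (h : ∀ x, ZSafe Φ Z x ↔ ZSafe Ψ Z x) : phase1Step Φ Z i = phase1Step Ψ Z i := by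
  have hs : safePositions Φ Z i = safePositions Ψ Z i := by
    simp only [safePositions, hi, h]
  simp only [phase1Step, hs, hi]

/-- Since safety ignores `y`, step `i` reads only `y i`. Hence the loop has independent inputs, as
`expect_foldl_le` requires. -/
theorem phase1Step_resample (Φ : Formula k n m) (y : Fin m → Fin k → Fin n) (Z : Finset (Fin n))
    (i : Fin m) : phase1Step (resample Φ y) Z i = phase1Step (resample Φ fun _ => y i) Z i :=
  phase1Step_congr rfl fun x => by rw [zSafe_resample, zSafe_resample]

theorem phase1_resample (Φ : Formula k n m) (y : Fin m → Fin k → Fin n) :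
    phase1 (resample Φ y) =
      (List.finRange m).foldl (fun Z i => phase1Step (resample Φ fun _ => y i) Z i) ∅ := by
  unfold phase1
  congr 1
  funext Z i
  exact phase1Step_resample Φ y Z i

end Resampling

/-! ### Deterministic effect of one step on `Z` and on the unsatisfied clauses. -/

section Phase1Step

variable {k n m : ℕ}

theorem phase1Step_of_not {Φ : Formula k n m} {Z : Finset (Fin n)} {i : Fin m}
    (h : ¬ (AllNegative (Φ i) ∧ ¬ MeetsVars Z (Φ i))) : phase1Step Φ Z i = Z := by
  simp only [phase1Step, h, if_false]

theorem phase1Step_of_pos (hk : 0 < k) {Φ : Formula k n m} {Z : Finset (Fin n)} {i : Fin m}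
    (h : AllNegative (Φ i) ∧ ¬ MeetsVars Z (Φ i)) :
    (∃ j, ZSafe Φ Z (Φ i j).1 ∧ phase1Step Φ Z i = insert (Φ i j).1 Z) ∨
      (∀ j : Fin k, (j : ℕ) + 1 < k₁ k → ¬ ZSafe Φ Z (Φ i j).1) ∧
        phase1Step Φ Z i = insert (Φ i ⟨k₁ k - 1, k₁_sub_one_lt hk⟩).1 Z := by
  by_cases hs : (safePositions Φ Z i).Nonempty
  · left
    refine ⟨(safePositions Φ Z i).min' hs, ?_, ?_⟩
    · exact (Finset.mem_filter.1 (Finset.min'_mem _ hs)).2.2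
    · unfold phase1Step
      rw [if_pos h, dif_pos hs]
  · right
    refine ⟨fun j hj hsafe => hs ⟨j, Finset.mem_filter.2 ⟨Finset.mem_univ _, hj, hsafe⟩⟩, ?_⟩
    unfold phase1Step
    rw [if_pos h, dif_neg hs, dif_pos hk]

theorem phase1Step_of_pos' (hk : 0 < k) {Φ : Formula k n m} {Z : Finset (Fin n)} {i : Fin m}
    (h : AllNegative (Φ i) ∧ ¬ MeetsVars Z (Φ i)) :
    ∃ j, phase1Step Φ Z i = insert (Φ i j).1 Z := by
  rcases phase1Step_of_pos hk h with ⟨j, -, hj⟩ | ⟨-, hj⟩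
  exacts [⟨j, hj⟩, ⟨_, hj⟩]

theorem subset_phase1Step (hk : 0 < k) (Φ : Formula k n m) (Z : Finset (Fin n)) (i : Fin m) :
    Z ⊆ phase1Step Φ Z i := by
  by_cases h : AllNegative (Φ i) ∧ ¬ MeetsVars Z (Φ i)
  · obtain ⟨j, hj⟩ := phase1Step_of_pos' hk h
    rw [hj]
    exact Finset.subset_insert _ _
  · rw [phase1Step_of_not h]

theorem subset_foldl_phase1Step (hk : 0 < k) (Φ : Formula k n m) (l : List (Fin m))
    (Z : Finset (Fin n)) : Z ⊆ l.foldl (phase1Step Φ) Z := by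
  induction l generalizing Z with
  | nil => exact subset_rfl
  | cons i l ih => exact (subset_phase1Step hk Φ Z i).trans (ih _)

theorem MeetsVars.mono {Z Z' : Finset (Fin n)} {C : Clause k n} (h : MeetsVars Z C)
    (hZ : Z ⊆ Z') : MeetsVars Z' C := by
  obtain ⟨j, hj⟩ := h
  exact ⟨j, hZ hj⟩

theorem meetsVars_phase1Step (hk : 0 < k) {Φ : Formula k n m} (Z : Finset (Fin n)) {i : Fin m}
    (h : AllNegative (Φ i)) : MeetsVars (phase1Step Φ Z i) (Φ i) := by
  by_cases hm : MeetsVars Z (Φ i)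
  · exact hm.mono (subset_phase1Step hk Φ Z i)
  · obtain ⟨j, hj⟩ := phase1Step_of_pos' hk ⟨h, hm⟩
    rw [hj]
    exact ⟨j, Finset.mem_insert_self _ _⟩

theorem meetsVars_phase1 (hk : 0 < k) {Φ : Formula k n m} {i : Fin m}
    (h : AllNegative (Φ i)) : MeetsVars (phase1 Φ) (Φ i) := by
  have : ∀ (l : List (Fin m)) (Z : Finset (Fin n)), i ∈ l →
      MeetsVars (l.foldl (phase1Step Φ) Z) (Φ i) := by
    intro l
    induction l with
    | nil => simp
    | cons j l ih =>
      intro Z hi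
      rcases List.mem_cons.1 hi with rfl | hi
      · exact (meetsVars_phase1Step hk Z h).mono (subset_foldl_phase1Step hk Φ l _)
      · exact ih _ hi
  exact this _ _ (List.mem_finRange i)

theorem not_satisfies_iff {Z : Finset (Fin n)} {C : Clause k n} :
    ¬ Satisfies (sigma Z) C ↔ ∀ j, FalseLit Z (C j) := by
  simp only [Satisfies, sigma, FalseLit, not_exists]
  refine forall_congr' fun j => ?_
  cases (C j).2 <;> simp

/-- The number of unsatisfied clauses under `σ_Z`, not counting the all-negative clauses and the
clauses with a repeated variable. -/
def numMixedUnsat (Φ : Formula k n m) (Z : Finset (Fin n)) : ℕ :=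
  (Finset.univ.filter fun i => (¬ AllNegative (Φ i) ∧ DistinctVars (Φ i)) ∧
    ∀ j, FalseLit Z (Φ i j)).card

/-- The number of `Z`-unique clauses in which `x` is the unique true variable. -/
def numUniqueAt (Φ : Formula k n m) (Z : Finset (Fin n)) (x : Fin n) : ℕ :=
  (Finset.univ.filter fun i => UniqueAt Z (Φ i) x).card

/-- Each all-negative clause meets the final `Z`, because `Z` only grows, and is therefore
satisfied. -/
theorem numUnsat_phase1_le (hk : 0 < k) (Φ : Formula k n m) :
    numUnsat Φ (sigma (phase1 Φ)) ≤ numMixedUnsat Φ (phase1 Φ) +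
      (Finset.univ.filter fun i => ¬ DistinctVars (Φ i)).card := by
  refine le_trans (Finset.card_le_card fun i hi => ?_) (Finset.card_union_le _ _)
  have hi := not_satisfies_iff.1 (Finset.mem_filter.1 hi).2
  simp only [Finset.mem_union, Finset.mem_filter, Finset.mem_univ, true_and]
  by_cases hd : DistinctVars (Φ i)
  · refine Or.inl ⟨⟨fun ha => ?_, hd⟩, hi⟩
    obtain ⟨j, hj⟩ := meetsVars_phase1 hk ha
    have := (hi j).2 hj
    simp [ha j] at this
  · exact Or.inr hd

theorem numMixedUnsat_empty (Φ : Formula k n m) : numMixedUnsat Φ ∅ = 0 := by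
  refine Finset.card_eq_zero.2 (Finset.filter_eq_empty_iff.2 fun i _ h => h.1.1 fun j => ?_)
  simpa [FalseLit] using h.2 j

/-- A newly falsified clause had all its true literals equal to `x`. Distinctness of variables
leaves a single such position, so the clause was `Z`-unique; with `x` occurring twice this would
fail. -/
theorem numMixedUnsat_insert_le (Φ : Formula k n m) {Z : Finset (Fin n)} {x : Fin n}
    (hx : x ∉ Z) : numMixedUnsat Φ (insert x Z) ≤ numMixedUnsat Φ Z + numUniqueAt Φ Z x := by
  refine le_trans (Finset.card_le_card fun i hi => ?_) (Finset.card_union_le _ _)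
  obtain ⟨⟨ha, hd⟩, hi⟩ := (Finset.mem_filter.1 hi).2
  simp only [Finset.mem_union, Finset.mem_filter, Finset.mem_univ, true_and]
  by_cases h : ∀ j, FalseLit Z (Φ i j)
  · exact Or.inl ⟨⟨ha, hd⟩, h⟩
  right
  have key : ∀ j, (Φ i j).2 = true → (Φ i j).1 ∉ Z → (Φ i j).1 = x := fun j h1 h2 =>
    (Finset.mem_insert.1 ((hi j).1 h1)).resolve_right h2
  have hneg : ∀ j, (Φ i j).2 = false → (Φ i j).1 ∉ Z := fun j h1 h2 => by
    have := (hi j).2 (Finset.mem_insert_of_mem h2)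
    simp [h1] at this
  obtain ⟨j, hj⟩ := not_forall.1 h
  have hj1 : (Φ i j).2 = true := by
    by_contra h1
    rw [Bool.not_eq_true] at h1
    exact hj (by simp [FalseLit, h1, hneg j h1])
  have hj2 : (Φ i j).1 ∉ Z := fun h2 => hj (by simp [FalseLit, hj1, h2])
  refine ⟨hx, ⟨⟨j, ⟨hj1, hj2⟩, fun j' hj' => hd _ _ ?_⟩, hneg⟩, j, Prod.ext (key j hj1 hj2) hj1⟩
  rw [key j hj1 hj2, key j' hj'.1 hj'.2]

theorem numMixedUnsat_resample (Φ : Formula k n m) (y : Fin m → Fin k → Fin n)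
    (Z : Finset (Fin n)) : numMixedUnsat (resample Φ y) Z = numMixedUnsat Φ Z := by
  unfold numMixedUnsat
  congr 1
  refine Finset.filter_congr fun i _ => ?_
  by_cases h : AllNegative (Φ i)
  · have := allNegative_resampleClause (v := y i) |>.2 h
    simp [resample, h, this]
  · simp [resample, resampleClause, h]

theorem sum_numUniqueAt_le (Φ : Formula k n m) (Z : Finset (Fin n)) :
    ∑ x, numUniqueAt Φ Z x ≤ numZUnique Φ Z := by
  simp only [numUniqueAt, numZUnique, Finset.card_filter]
  rw [Finset.sum_comm]
  refine Finset.sum_le_sum fun i _ => ?_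
  rw [← Finset.card_filter]
  split_ifs with h
  · exact Finset.card_le_one.2 fun x hx x' hx' =>
      (Finset.mem_filter.1 hx).2.eq (Finset.mem_filter.1 hx').2
  · exact (Finset.card_eq_zero.2 (Finset.filter_eq_empty_iff.2 fun x _ hx => h hx.2.1)).le

theorem ZSafe.numUniqueAt_eq_zero {Φ : Formula k n m} {Z : Finset (Fin n)} {x : Fin n}
    (h : ZSafe Φ Z x) : numUniqueAt Φ Z x = 0 :=
  Finset.card_eq_zero.2 (Finset.filter_eq_empty_iff.2 fun i _ => (zSafe_iff.1 h).2 i)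

end Phase1Step

/-! ### Exponential potentials for the resampled chain. -/

section Drift

open scoped BigOperators

variable {k n m : ℕ}

theorem expect_notMem (hn : 0 < n) (S : Finset (Fin n)) :
    (𝔼 x, if x ∉ S then (1 : ℝ) else 0) = 1 - S.card / n := by
  have hn' : (n : ℝ) ≠ 0 := by positivity
  rw [Fintype.expect_eq_sum_div_card, ← Finset.sum_filter, Finset.sum_const, nsmul_eq_mul, mul_one,
    Fintype.card_fin]
  have : (Finset.univ.filter fun x => x ∉ S) = Sᶜ := by ext; simp
  rw [this, Finset.card_compl, Fintype.card_fin, Nat.cast_sub (card_finset_fin_le S)]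
  field_simp

theorem one_sub_div_pow_le {a n : ℝ} (h : a ≤ n) (hn : 0 < n) (j : ℕ) :
    (1 - a / n) ^ j ≤ Real.exp (-(j * a / n)) := by
  have h1 : a / n ≤ 1 := (div_le_one hn).2 h
  calc _ ≤ Real.exp (-(a / n)) ^ j :=
        pow_le_pow_left₀ (by linarith) (by linarith [Real.add_one_le_exp (-(a / n))]) j
    _ = _ := by rw [← Real.exp_nat_mul]; ring_nf

theorem expect_forall_notMem_le (hn : 0 < n) (Z : Finset (Fin n)) :
    (𝔼 v : Fin k → Fin n, if ∀ j, v j ∉ Z then (1 : ℝ) else 0) ≤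
      Real.exp (-(k * Z.card / n)) := by
  have h : ∀ v : Fin k → Fin n, (if ∀ j, v j ∉ Z then (1 : ℝ) else 0) =
      ∏ j, if v j ∉ Z then (1 : ℝ) else 0 := fun v => by rw [Fintype.prod_ite_zero]; simp
  simp only [h]
  rw [expect_pi_prod fun _ x => if x ∉ Z then (1 : ℝ) else 0]
  rw [Finset.prod_const, expect_notMem hn, Finset.card_univ, Fintype.card_fin]
  exact one_sub_div_pow_le (Nat.cast_le.2 (card_finset_fin_le Z)) (Nat.cast_pos.2 hn) k

/-- The number of all-negative clauses. -/
def numAllNegative (Φ : Formula k n m) : ℕ := (Finset.univ.filter fun i => AllNegative (Φ i)).card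

theorem prod_ite_allNegative (Φ : Formula k n m) (a : ℝ) :
    (∏ i, if AllNegative (Φ i) then Real.exp a else 1) = Real.exp (numAllNegative Φ * a) := by
  rw [← Finset.prod_filter, Finset.prod_const, Real.exp_nat_mul, numAllNegative]

/-- Drift bound for Phase 1 with resampled all-negative clauses. -/
theorem expect_phase1_resample_le (hn : 0 < n) (Φ : Formula k n m) {W : Finset (Fin n) → ℝ} {a : ℝ}
    (h : ∀ i Z, AllNegative (Φ i) →
      𝔼 v : Fin k → Fin n, W (phase1Step (resample Φ fun _ => v) Z i) ≤ Real.exp a * W Z) :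
    𝔼 y, W (phase1 (resample Φ y)) ≤ Real.exp (numAllNegative Φ * a) * W ∅ := by
  have : Nonempty (Fin n) := ⟨⟨0, hn⟩⟩
  rw [← prod_ite_allNegative]
  simp only [phase1_resample]
  refine expect_foldl_le (fun i Z v => phase1Step (resample Φ fun _ => v) Z i)
    (fun i => by split_ifs <;> positivity) (fun i Z => ?_) ∅
  split_ifs with hi
  · exact h i Z hi
  · rw [one_mul]
    refine Finset.expect_le Finset.univ_nonempty fun v _ => le_of_eq ?_
    rw [phase1Step_of_not]
    exact fun h' => hi (allNegative_resampleClause.1 h'.1)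

theorem prob_lt_card_phase1_le (hn : 0 < n) (hk : 0 < k) (Φ : Formula k n m) {h : ℝ} (hh : 0 ≤ h)
    (T : ℝ) :
    prob {y | T < ((phase1 (resample Φ y)).card : ℝ)} ≤
      Real.exp (numAllNegative Φ * (2 * Real.exp (-(k * (h - 1) / n))) - (T - h)) := by
  have : Nonempty (Fin n) := ⟨⟨0, hn⟩⟩
  have hn' : (0 : ℝ) < n := Nat.cast_pos.2 hn
  -- The potential is flat up to size `h` and exponential beyond it. Only steps from sets with more
  -- than `h - 1` elements can raise it, and these need a tuple that misses such a set.
  let W : Finset (Fin n) → ℝ := fun Z => max 1 (Real.exp (Z.card - h))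
  have hW : ∀ Z, 0 < W Z := fun Z => lt_max_of_lt_left one_pos
  have key := expect_phase1_resample_le hn Φ (W := W)
    (a := 2 * Real.exp (-(k * (h - 1) / n))) fun i Z hi => by
      have hstep : ∀ v : Fin k → Fin n, (∃ j, v j ∈ Z) →
          phase1Step (resample Φ fun _ => v) Z i = Z := fun v ⟨j, hj⟩ =>
        phase1Step_of_not fun h' => h'.2 ⟨j, by simpa [resample, resampleClause, hi] using hj⟩
      have hcard : ∀ v : Fin k → Fin n,
          ((phase1Step (resample Φ fun _ => v) Z i).card : ℝ) ≤ Z.card + 1 := fun v => by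
        by_cases h' : AllNegative (resample Φ (fun _ => v) i) ∧
            ¬ MeetsVars Z (resample Φ (fun _ => v) i)
        · obtain ⟨j, hj⟩ := phase1Step_of_pos' hk h'
          rw [hj]
          exact_mod_cast Finset.card_insert_le _ _
        · rw [phase1Step_of_not h']; linarith
      by_cases hc : (Z.card : ℝ) + 1 ≤ h
      · refine Finset.expect_le Finset.univ_nonempty fun v _ => ?_
        have h1 : W (phase1Step (resample Φ fun _ => v) Z i) = 1 :=
          max_eq_left (Real.exp_le_one_iff.2 (by linarith [hcard v]))
        rw [h1]
        exact one_le_mul_of_one_le_of_one_le (Real.one_le_exp (by positivity)) (le_max_left _ _)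
      · push Not at hc
        calc _ ≤ 𝔼 v : Fin k → Fin n, W Z * (1 + 2 * if ∀ j, v j ∉ Z then (1 : ℝ) else 0) := by
              refine Finset.expect_le_expect fun v _ => ?_
              split_ifs with hv
              -- One more element multiplies the potential by at most `e ≤ 3 = 1 + 2`.
              · have h3 : Real.exp 1 ≤ 3 := by linarith [Real.exp_one_lt_d9]
                refine max_le ?_ ?_
                · nlinarith [le_max_left 1 (Real.exp (Z.card - h))]
                · calc _ ≤ Real.exp ((Z.card - h) + 1) :=
                        Real.exp_le_exp.2 (by linarith [hcard v])
                    _ = Real.exp (Z.card - h) * Real.exp 1 := Real.exp_add _ _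
                    _ ≤ W Z * 3 := mul_le_mul (le_max_right _ _) h3 (Real.exp_pos _).le (hW Z).le
                    _ = _ := by ring
              · rw [hstep v (by simpa using hv)]; simp
          _ ≤ W Z * (1 + 2 * Real.exp (-(k * (h - 1) / n))) := by
              rw [← Finset.mul_expect, Finset.expect_add_distrib, Fintype.expect_const,
                ← Finset.mul_expect]
              have h1 := (expect_forall_notMem_le (k := k) hn Z).trans
                (Real.exp_le_exp.2 (neg_le_neg (div_le_div_of_nonneg_right
                  (mul_le_mul_of_nonneg_left (show h - 1 ≤ Z.card by linarith)
                    (Nat.cast_nonneg k)) hn'.le)))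
              exact mul_le_mul_of_nonneg_left (by linarith) (hW Z).le
          _ ≤ _ := by
              rw [mul_comm]
              exact mul_le_mul_of_nonneg_right
                (by linarith [Real.add_one_le_exp (2 * Real.exp (-(k * (h - 1) / n)))]) (hW Z).le
  have hW0 : W ∅ = 1 := max_eq_left (Real.exp_le_one_iff.2 (by simpa using hh))
  rw [hW0, mul_one] at key
  rw [Real.exp_sub]
  refine (prob_le_expect_div (F := fun y => W (phase1 (resample Φ y))) (Real.exp_pos _)
    (fun y => (hW _).le) fun y hy => ?_).trans
    (div_le_div_of_nonneg_right key (Real.exp_pos _).le)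
  have hy : T < ((phase1 (resample Φ y)).card : ℝ) := hy
  exact le_max_of_le_right (Real.exp_le_exp.2 (by linarith))

/-- The test on earlier positions and the variable in position `k₁` use disjoint coordinates, so the
mean factors. This is why the search stops before `k₁`. -/
theorem expect_fallback_le (hn : 0 < n) (hk : 0 < k) (S : Finset (Fin n)) (f : Fin n → ℝ)
    (hf : ∀ x, 0 ≤ f x) :
    (𝔼 v : Fin k → Fin n, (if ∀ j : Fin k, (j : ℕ) + 1 < k₁ k → v j ∉ S then (1 : ℝ) else 0) *
      f (v ⟨k₁ k - 1, k₁_sub_one_lt hk⟩)) ≤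
      Real.exp (-((k₁ k - 1 : ℕ) * S.card / n)) * 𝔼 x, f x := by
  have : Nonempty (Fin n) := ⟨⟨0, hn⟩⟩
  set j₀ : Fin k := ⟨k₁ k - 1, k₁_sub_one_lt hk⟩ with hj₀
  have hk1 : 1 ≤ k₁ k := by unfold k₁; omega
  let F : Fin k → Fin n → ℝ := fun j x =>
    (if (j : ℕ) + 1 < k₁ k then (if x ∉ S then 1 else 0) else 1) * if j = j₀ then f x else 1
  have h : ∀ v : Fin k → Fin n,
      (if ∀ j : Fin k, (j : ℕ) + 1 < k₁ k → v j ∉ S then (1 : ℝ) else 0) * f (v j₀) =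
        ∏ j, F j (v j) := by
    intro v
    simp only [F, Finset.prod_mul_distrib, Finset.prod_ite_eq', Finset.mem_univ, if_true]
    congr 1
    have : ∀ j : Fin k, (if (j : ℕ) + 1 < k₁ k then (if v j ∉ S then (1 : ℝ) else 0) else 1) =
        if (j : ℕ) + 1 < k₁ k → v j ∉ S then (1 : ℝ) else 0 := by
      intro j; by_cases h1 : (j : ℕ) + 1 < k₁ k <;> simp [h1]
    simp only [this]
    rw [Fintype.prod_ite_zero]; simp
  have hE : ∀ j, 𝔼 x, F j x = (if (j : ℕ) + 1 < k₁ k then (1 - S.card / n : ℝ) else 1) *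
      if j = j₀ then 𝔼 x, f x else 1 := by
    intro j
    by_cases hj : j = j₀
    · have : ¬ ((j : ℕ) + 1 < k₁ k) := by rw [hj, hj₀]; simp only; omega
      simp [F, hj, hj ▸ this]
    · by_cases h1 : (j : ℕ) + 1 < k₁ k
      · simpa [F, hj, h1] using expect_notMem hn S
      · simp [F, hj, h1]
  simp only [h]
  rw [expect_pi_prod]
  simp only [hE, Finset.prod_mul_distrib, Finset.prod_ite_eq', Finset.mem_univ, if_true]
  refine mul_le_mul_of_nonneg_right ?_ (Finset.expect_nonneg fun x _ => hf x)
  rw [← Finset.prod_filter, Finset.prod_const]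
  have hc : (Finset.univ.filter fun j : Fin k => (j : ℕ) + 1 < k₁ k).card = k₁ k - 1 := by
    have : (Finset.univ.filter fun j : Fin k => (j : ℕ) + 1 < k₁ k) = Finset.Iio j₀ := by
      ext j
      simp only [Finset.mem_filter, Finset.mem_univ, true_and, Finset.mem_Iio, hj₀, Fin.lt_def]
      omega
    rw [this, Fin.card_Iio]
  rw [hc]
  exact one_sub_div_pow_le (Nat.cast_le.2 (card_finset_fin_le S)) (Nat.cast_pos.2 hn) _

theorem numMixedUnsat_phase1Step_le (hk : 0 < k) {Φ : Formula k n m} (Z : Finset (Fin n))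
    {i : Fin m} (hi : AllNegative (Φ i)) (v : Fin k → Fin n) :
    numMixedUnsat Φ (phase1Step (resample Φ fun _ => v) Z i) ≤ numMixedUnsat Φ Z ∨
      (∀ j : Fin k, (j : ℕ) + 1 < k₁ k → ¬ ZSafe Φ Z (v j)) ∧
      numMixedUnsat Φ (phase1Step (resample Φ fun _ => v) Z i) ≤
        numMixedUnsat Φ Z + numUniqueAt Φ Z (v ⟨k₁ k - 1, k₁_sub_one_lt hk⟩) := by
  have hv : ∀ j, (resample Φ (fun _ => v) i j).1 = v j := fun j => by
    simp [resample, resampleClause, hi]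
  by_cases h : AllNegative (resample Φ (fun _ => v) i) ∧ ¬ MeetsVars Z (resample Φ (fun _ => v) i)
  · rcases phase1Step_of_pos hk h with ⟨j, hj, hj'⟩ | ⟨hj, hj'⟩
    · left
      rw [zSafe_resample, hv] at hj
      rw [hj', hv]
      simpa [hj.numUniqueAt_eq_zero] using numMixedUnsat_insert_le Φ (zSafe_iff.1 hj).1
    · right
      refine ⟨fun j hjk hsafe => hj j hjk ?_, ?_⟩
      · rwa [zSafe_resample, hv]
      · rw [hj', hv]
        refine numMixedUnsat_insert_le Φ fun hmem => h.2 ⟨⟨k₁ k - 1, k₁_sub_one_lt hk⟩, ?_⟩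
        rw [hv]
        exact hmem
  · left
    rw [phase1Step_of_not h]

/-- The count rises only in a fallback step, of probability at most `exp(-(k₁ - 1)s/n)`. The added
variable is then uniform and lies in at most `K/n` unique clauses on average. -/
theorem prob_lt_numMixedUnsat_le (hn : 0 < n) (hk : 0 < k) (Φ : Formula k n m) {θ s K l : ℝ}
    (hl : 0 ≤ l)
    (hsafe : ∀ Z : Finset (Fin n), (Z.card : ℝ) ≤ θ →
      s ≤ (Finset.univ.filter fun x => ZSafe Φ Z x).card)
    (huniq : ∀ Z : Finset (Fin n), (Z.card : ℝ) ≤ θ → (numZUnique Φ Z : ℝ) ≤ K)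
    (hdeg : ∀ Z x, l * numUniqueAt Φ Z x ≤ 1) (T : ℝ) :
    prob {y | ((phase1 (resample Φ y)).card : ℝ) ≤ θ ∧
      T < (numMixedUnsat Φ (phase1 (resample Φ y)) : ℝ)} ≤
      Real.exp (numAllNegative Φ *
        (Real.exp (-((k₁ k - 1 : ℕ) * s / n)) * (2 * l * K / n)) - l * T) := by
  have : Nonempty (Fin n) := ⟨⟨0, hn⟩⟩
  have hn' : (0 : ℝ) < n := Nat.cast_pos.2 hn
  -- Killing the potential above size `θ` makes the hypotheses on small sets available at every step
  -- that matters. As `Z` only grows, it stays zero from then on.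
  let W : Finset (Fin n) → ℝ := fun Z =>
    if (Z.card : ℝ) ≤ θ then Real.exp (l * numMixedUnsat Φ Z) else 0
  have hW : ∀ Z, 0 ≤ W Z := fun Z => by simp only [W]; split_ifs <;> positivity
  have hWle : ∀ Z, W Z ≤ Real.exp (l * numMixedUnsat Φ Z) := fun Z => by
    simp only [W]; split_ifs
    · rfl
    · positivity
  set ρ := Real.exp (-((k₁ k - 1 : ℕ) * s / n)) with hρ
  have key := expect_phase1_resample_le hn Φ (W := W) (a := ρ * (2 * l * K / n)) fun i Z hi => by
    by_cases hZ : (Z.card : ℝ) ≤ θ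
    · set S := Finset.univ.filter fun x => ZSafe Φ Z x with hS
      let f : Fin n → ℝ := fun x => 2 * l * numUniqueAt Φ Z x
      have hf : ∀ x, 0 ≤ f x := fun x => by positivity
      have hWZ : W Z = Real.exp (l * numMixedUnsat Φ Z) := if_pos hZ
      calc _ ≤ 𝔼 v : Fin k → Fin n, W Z * (1 +
            (if ∀ j : Fin k, (j : ℕ) + 1 < k₁ k → v j ∉ S then (1 : ℝ) else 0) *
              f (v ⟨k₁ k - 1, k₁_sub_one_lt hk⟩)) := by
            refine Finset.expect_le_expect fun v _ => ?_
            refine (hWle _).trans ?_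
            have h0 : 0 ≤ (if ∀ j : Fin k, (j : ℕ) + 1 < k₁ k → v j ∉ S then (1 : ℝ) else 0) *
              f (v ⟨k₁ k - 1, k₁_sub_one_lt hk⟩) :=
                mul_nonneg (by split_ifs <;> norm_num) (hf _)
            rcases numMixedUnsat_phase1Step_le hk Z hi v with h | ⟨h1, h2⟩
            · refine le_trans (Real.exp_le_exp.2 (mul_le_mul_of_nonneg_left
                (Nat.cast_le.2 h) hl)) ?_
              rw [← hWZ]
              exact le_mul_of_one_le_right (hW Z) (by linarith)
            · have h3 : ∀ j : Fin k, (j : ℕ) + 1 < k₁ k → v j ∉ S := fun j hj => by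
                simpa [hS] using h1 j hj
              rw [if_pos h3, one_mul, hWZ]
              set x := v ⟨k₁ k - 1, k₁_sub_one_lt hk⟩
              -- The degree bound puts the exponent in `[0, 1]`, where `eᵗ ≤ 1 + 2t`.
              have h4 : Real.exp (l * numUniqueAt Φ Z x) ≤ 1 + f x := by
                have h5 := Real.abs_exp_sub_one_le (x := l * numUniqueAt Φ Z x)
                  (by rw [abs_of_nonneg (by positivity)]; exact hdeg Z x)
                rw [abs_of_nonneg (by positivity : 0 ≤ l * (numUniqueAt Φ Z x : ℝ))] at h5
                have := le_abs_self (Real.exp (l * numUniqueAt Φ Z x) - 1)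
                simp only [f]
                linarith
              calc _ ≤ Real.exp (l * numMixedUnsat Φ Z + l * numUniqueAt Φ Z x) := by
                    rw [← mul_add]
                    exact Real.exp_le_exp.2 (mul_le_mul_of_nonneg_left (by exact_mod_cast h2) hl)
                _ ≤ _ := by
                    rw [Real.exp_add]
                    exact mul_le_mul_of_nonneg_left h4 (Real.exp_pos _).le
        _ ≤ W Z * (1 + ρ * (2 * l * K / n)) := by
            rw [← Finset.mul_expect, Finset.expect_add_distrib, Fintype.expect_const]
            refine mul_le_mul_of_nonneg_left ((add_le_add_iff_left _).2 ?_) (hW Z)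
            refine (expect_fallback_le hn hk S f hf).trans (mul_le_mul ?_ ?_
              (Finset.expect_nonneg fun x _ => hf x) (Real.exp_pos _).le)
            · refine Real.exp_le_exp.2 (neg_le_neg (div_le_div_of_nonneg_right
                (mul_le_mul_of_nonneg_left (hsafe Z hZ) (Nat.cast_nonneg _)) hn'.le))
            · rw [← Finset.mul_expect, Fintype.expect_eq_sum_div_card, Fintype.card_fin,
                mul_div_assoc]
              refine mul_le_mul_of_nonneg_left (div_le_div_of_nonneg_right
                (le_trans ?_ (huniq Z hZ)) hn'.le) (by positivity)
              exact_mod_cast sum_numUniqueAt_le Φ Z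
        _ ≤ _ := by
            have h1 := Real.add_one_le_exp (ρ * (2 * l * K / n))
            rw [mul_comm]
            exact mul_le_mul_of_nonneg_right (by linarith) (hW Z)
    · refine Finset.expect_le Finset.univ_nonempty fun v _ => ?_
      have h1 : W (phase1Step (resample Φ fun _ => v) Z i) = 0 := if_neg fun h => hZ <|
        le_trans (Nat.cast_le.2 (Finset.card_le_card (subset_phase1Step hk _ Z i))) h
      rw [h1]
      exact mul_nonneg (Real.exp_pos _).le (hW Z)
  have hW0 : W ∅ ≤ 1 := (hWle ∅).trans (by simp [numMixedUnsat_empty])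
  rw [Real.exp_sub]
  refine (prob_le_expect_div (F := fun y => W (phase1 (resample Φ y))) (Real.exp_pos _)
    (fun y => hW _) fun y hy => ?_).trans (div_le_div_of_nonneg_right
      (key.trans (mul_le_of_le_one_right (Real.exp_pos _).le hW0)) (Real.exp_pos _).le)
  simp only [W]
  rw [if_pos hy.1]
  exact Real.exp_le_exp.2 (mul_le_mul_of_nonneg_left hy.2.le hl)

end Drift

/-! ### Exceptional formulas and the resulting failure bound. -/

section Events

variable {k n m : ℕ}

/-- Some set `Z` of size at most `θ` has more than `K` many `Z`-unique clauses. -/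
def manyUnique (k n m : ℕ) (θ K : ℝ) : Set (Formula k n m) :=
  {Φ | ∃ Z : Finset (Fin n), (Z.card : ℝ) ≤ θ ∧ K < numZUnique Φ Z}

/-- For some set `Z` of size at most `θ` there are fewer than `s` many `Z`-safe variables. -/
def fewSafe (k n m : ℕ) (θ s : ℝ) : Set (Formula k n m) :=
  {Φ | ∃ Z : Finset (Fin n), (Z.card : ℝ) ≤ θ ∧
    ((Finset.univ.filter fun x => ZSafe Φ Z x).card : ℝ) < s}

/-- Some variable occurs positively in more than `D` clauses. -/
def highDegree (k n m : ℕ) (D : ℝ) : Set (Formula k n m) :=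
  {Φ | ∃ x : Fin n, D < (Finset.univ.filter fun i => ∃ j, Φ i j = (x, true)).card}

/-- There are more than `N` all-negative clauses. -/
def manyAllNegative (k n m : ℕ) (N : ℝ) : Set (Formula k n m) := {Φ | N < numAllNegative Φ}

/-- There are more than `T` clauses with a repeated variable. -/
def manyRepeated (k n m : ℕ) (T : ℝ) : Set (Formula k n m) :=
  {Φ | T < (Finset.univ.filter fun i => ¬ DistinctVars (Φ i)).card}

/-- The set produced by Phase 1 depends on the formula, so estimates for fixed `Z` must hold for all
small `Z` at once. -/
theorem prob_exists_small_le {θ y b : ℝ} (hy₀ : 0 < y) (hy₁ : y ≤ 1)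
    (S : Finset (Fin n) → Set (Formula k n m))
    (hS : ∀ Z : Finset (Fin n), (Z.card : ℝ) ≤ θ → prob (S Z) ≤ Real.exp b) :
    prob {Φ | ∃ Z : Finset (Fin n), (Z.card : ℝ) ≤ θ ∧ Φ ∈ S Z} ≤
      Real.exp (n * y - θ * Real.log y + b) := by
  have h := prob_exists_le
    ((Finset.univ : Finset (Finset (Fin n))).filter fun Z => (Z.card : ℝ) ≤ θ) S
  simp only [Finset.mem_filter, Finset.mem_univ, true_and] at h
  rw [Real.exp_add]
  refine h.trans ((Finset.sum_le_card_nsmul _ _ _ fun Z hZ =>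
    hS Z (Finset.mem_filter.1 hZ).2).trans ?_)
  rw [nsmul_eq_mul]
  exact mul_le_mul_of_nonneg_right (card_filter_card_le θ hy₀ hy₁) (Real.exp_pos _).le

theorem prob_manyUnique_le (hn : 0 < n) {θ K y l : ℝ} (hy₀ : 0 < y) (hy₁ : y ≤ 1) (hl : 0 ≤ l) :
    prob (manyUnique k n m θ K) ≤ Real.exp (n * y - θ * Real.log y +
      (m * (k / 2 ^ k) * (Real.exp l - 1) - l * K)) := by
  have : Nonempty (Fin n) := ⟨⟨0, hn⟩⟩
  exact prob_exists_small_le hy₀ hy₁ (fun Z => {Φ | K < numZUnique Φ Z}) fun Z _ =>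
    prob_lt_card_le (fun C => ZUnique Z C) K (expect_zUnique_le hn Z) hl

/-- Occupancy with clauses as balls and the variables outside `Z` as bins: a clause hits its unique
true variable, and the safe variables are the empty bins. -/
theorem prob_fewSafe_le (hn : 0 < n) {θ s y : ℝ} (hy₀ : 0 < y) (hy₁ : y ≤ 1) :
    prob (fewSafe k n m θ s) ≤ Real.exp (n * y - θ * Real.log y +
      (s - (1 - k / 2 ^ k / n) ^ m * (n - θ) / 2)) := by
  have : Nonempty (Fin n) := ⟨⟨0, hn⟩⟩
  have hn' : (1 : ℝ) ≤ n := Nat.one_le_cast.2 hn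
  have hp₁ : (k / 2 ^ k / n : ℝ) ≤ 1 := by
    rw [div_le_one (by linarith)]
    refine le_trans ?_ hn'
    rw [div_le_one (by positivity)]
    exact_mod_cast Nat.lt_two_pow_self.le
  refine prob_exists_small_le hy₀ hy₁
    (fun Z => {Φ | ((Finset.univ.filter fun x => ZSafe Φ Z x).card : ℝ) < s}) fun Z hZ => ?_
  have h := prob_card_unhit_lt_le (m := m) (fun (C : Clause k n) x => UniqueAt Z C x)
    (by positivity) hp₁ Zᶜ (fun C x _ x' _ h h' => h.eq h') (fun x _ => expect_uniqueAt_le hn Z x) s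
  have h1 : ∀ Φ : Formula k n m, (Zᶜ.filter fun x => ∀ i, ¬ UniqueAt Z (Φ i) x) =
      Finset.univ.filter fun x => ZSafe Φ Z x := by
    intro Φ
    ext x
    simp [zSafe_iff]
  simp only [h1] at h
  refine h.trans (Real.exp_le_exp.2 (sub_le_sub_left (div_le_div_of_nonneg_right
    (mul_le_mul_of_nonneg_left ?_ (pow_nonneg (by linarith) m)) zero_le_two) s))
  rw [Finset.card_compl, Fintype.card_fin, Nat.cast_sub (card_finset_fin_le Z)]
  linarith

theorem prob_manyAllNegative_le (hn : 0 < n) (N : ℝ) :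
    prob (manyAllNegative k n m N) ≤ Real.exp (m * (1 / 2 ^ k) * (Real.exp 1 - 1) - N) := by
  have : Nonempty (Fin n) := ⟨⟨0, hn⟩⟩
  have h := prob_lt_card_le (m := m) (fun C : Clause k n => AllNegative C) N
    (expect_allNegative hn).le zero_le_one
  rwa [one_mul] at h

theorem prob_manyRepeated_le (hn : 0 < n) (T : ℝ) :
    prob (manyRepeated k n m T) ≤ Real.exp (m * (k ^ 2 / n) * (Real.exp 1 - 1) - T) := by
  have : Nonempty (Fin n) := ⟨⟨0, hn⟩⟩
  have h := prob_lt_card_le (m := m) (fun C : Clause k n => ¬ DistinctVars C) T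
    (expect_not_distinctVars_le hn) zero_le_one
  rwa [one_mul] at h

theorem prob_highDegree_le (hn : 0 < n) (D : ℝ) :
    prob (highDegree k n m D) ≤ n * Real.exp (m * (k / 2 / n) * (Real.exp 1 - 1) - D) := by
  have : Nonempty (Fin n) := ⟨⟨0, hn⟩⟩
  have h := prob_exists_le (Finset.univ : Finset (Fin n)) fun x =>
    {Φ : Formula k n m | D < (Finset.univ.filter fun i => ∃ j, Φ i j = (x, true)).card}
  simp only [Finset.mem_univ, true_and] at h
  have hx : ∀ x : Fin n,
      prob {Φ : Formula k n m | D < (Finset.univ.filter fun i => ∃ j, Φ i j = (x, true)).card} ≤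
        Real.exp (m * (k / 2 / n) * (Real.exp 1 - 1) - D) := fun x => by
    have h := prob_lt_card_le (m := m) (fun C : Clause k n => ∃ j, C j = (x, true)) D
      (expect_occurs_le x) zero_le_one
    rwa [one_mul] at h
  refine h.trans ((Finset.sum_le_sum fun x _ => hx x).trans_eq ?_)
  simp

theorem numUniqueAt_le_degree (Φ : Formula k n m) (Z : Finset (Fin n)) (x : Fin n) :
    numUniqueAt Φ Z x ≤ (Finset.univ.filter fun i => ∃ j, Φ i j = (x, true)).card :=
  Finset.card_le_card fun i hi => Finset.mem_filter.2
    ⟨Finset.mem_univ i, (Finset.mem_filter.1 hi).2.2.2⟩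

theorem prob_phase1_bad_le (hn : 0 < n) (hk : 0 < k) {θ K s N D T : ℝ} (hθ : 0 ≤ θ) (hK : 0 ≤ K)
    (hD : 0 < D) :
    prob {Φ : Formula k n m | ¬ (((phase1 Φ).card : ℝ) ≤ θ ∧ (numZUnique Φ (phase1 Φ) : ℝ) ≤ K ∧
      (numUnsat Φ (sigma (phase1 Φ)) : ℝ) ≤ T + T)} ≤
      2 * prob (manyUnique k n m θ K) + prob (fewSafe k n m θ s) +
        2 * prob (manyAllNegative k n m N) + prob (highDegree k n m D) +
        prob (manyRepeated k n m T) +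
        Real.exp (N * (2 * Real.exp (-(k * (θ / 2 - 1) / n))) - θ / 2) +
        Real.exp (N * (Real.exp (-((k₁ k - 1 : ℕ) * s / n)) * (2 * D⁻¹ * K / n)) - D⁻¹ * T) := by
  set r₁ := Real.exp (N * (2 * Real.exp (-(k * (θ / 2 - 1) / n))) - θ / 2)
  set r₂ := Real.exp (N * (Real.exp (-((k₁ k - 1 : ℕ) * s / n)) * (2 * D⁻¹ * K / n)) - D⁻¹ * T)
  set B₁ : Set (Formula k n m) := {Φ | θ < ((phase1 Φ).card : ℝ)} with hB₁
  set B₂ : Set (Formula k n m) :=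
    {Φ | ((phase1 Φ).card : ℝ) ≤ θ ∧ T < (numMixedUnsat Φ (phase1 Φ) : ℝ)} with hB₂
  have h₁ : prob B₁ ≤ prob (manyAllNegative k n m N) + r₁ := by
    rw [← compl_compl (manyAllNegative k n m N)]
    refine prob_le_of_resample hn (Real.exp_pos _).le fun Φ hΦ => ?_
    have hN : (numAllNegative Φ : ℝ) ≤ N := not_lt.1 hΦ
    -- Half of `θ` is granted freely; the drift must then account for the other half.
    refine (prob_lt_card_phase1_le hn hk Φ (h := θ / 2) (by positivity) θ).trans
      (Real.exp_le_exp.2 ?_)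
    have := mul_le_mul_of_nonneg_right hN
      (by positivity : 0 ≤ 2 * Real.exp (-(k * (θ / 2 - 1) / n)))
    linarith
  have h₂ : prob B₂ ≤ prob (manyUnique k n m θ K ∪ (fewSafe k n m θ s ∪
      (manyAllNegative k n m N ∪ highDegree k n m D))) + r₂ := by
    rw [← compl_compl (manyUnique k n m θ K ∪ _)]
    refine prob_le_of_resample hn (Real.exp_pos _).le fun Φ hΦ => ?_
    simp only [Set.mem_compl_iff, Set.mem_union, not_or] at hΦ
    obtain ⟨hU, hS, hN, hdeg⟩ := hΦ
    have hN : (numAllNegative Φ : ℝ) ≤ N := not_lt.1 hN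
    have h := prob_lt_numMixedUnsat_le hn hk Φ (θ := θ) (s := s) (K := K) (l := D⁻¹)
      (inv_nonneg.2 hD.le)
      (fun Z hZ => not_lt.1 fun h => hS ⟨Z, hZ, h⟩) (fun Z hZ => not_lt.1 fun h => hU ⟨Z, hZ, h⟩)
      (fun Z x => by
        rw [inv_mul_le_one₀ hD]
        exact (Nat.cast_le.2 (numUniqueAt_le_degree Φ Z x)).trans
          (not_lt.1 fun h => hdeg ⟨x, h⟩)) T
    simp only [hB₂, Set.mem_ofPred_eq, numMixedUnsat_resample]
    refine h.trans (Real.exp_le_exp.2 (sub_le_sub_right ?_ _))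
    exact mul_le_mul_of_nonneg_right hN (by positivity)
  have hsub : {Φ : Formula k n m | ¬ (((phase1 Φ).card : ℝ) ≤ θ ∧
      (numZUnique Φ (phase1 Φ) : ℝ) ≤ K ∧ (numUnsat Φ (sigma (phase1 Φ)) : ℝ) ≤ T + T)} ⊆
      (manyUnique k n m θ K ∪ manyRepeated k n m T) ∪ (B₁ ∪ B₂) := by
    intro Φ hΦ
    by_contra hc
    simp only [Set.mem_union, not_or] at hc
    obtain ⟨⟨hU, hR⟩, hc₁, hc₂⟩ := hc
    have h1 : ((phase1 Φ).card : ℝ) ≤ θ := not_lt.1 hc₁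
    refine hΦ ⟨h1, not_lt.1 fun h => hU ⟨_, h1, h⟩, ?_⟩
    have h2 : (numMixedUnsat Φ (phase1 Φ) : ℝ) ≤ T := not_lt.1 fun h => hc₂ ⟨h1, h⟩
    have h3 : ((Finset.univ.filter fun i => ¬ DistinctVars (Φ i)).card : ℝ) ≤ T := not_lt.1 hR
    have h4 : (numUnsat Φ (sigma (phase1 Φ)) : ℝ) ≤ numMixedUnsat Φ (phase1 Φ) +
      (Finset.univ.filter fun i => ¬ DistinctVars (Φ i)).card := by
        exact_mod_cast numUnsat_phase1_le hk Φ
    linarith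
  have e1 := prob_mono hsub
  have e2 := prob_union_le (manyUnique k n m θ K ∪ manyRepeated k n m T) (B₁ ∪ B₂)
  have e3 := prob_union_le (manyUnique k n m θ K) (manyRepeated k n m T)
  have e4 := prob_union_le B₁ B₂
  have e5 := prob_union_le (manyUnique k n m θ K) (fewSafe k n m θ s ∪
      (manyAllNegative k n m N ∪ highDegree k n m D))
  have e6 := prob_union_le (fewSafe k n m θ s) (manyAllNegative k n m N ∪ highDegree k n m D)
  have e7 := prob_union_le (manyAllNegative k n m N) (highDegree k n m D)
  linarith

end Events

/-! ### Passage from averages to the uniform measure. -/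

section Measure

theorem uniformFormula_compl {k n m : ℕ} (hn : 0 < n) (S : Set (Formula k n m)) :
    uniformFormula k n m S = ENNReal.ofReal (1 - prob Sᶜ) := by
  classical
  have : Nonempty (Fin n) := ⟨⟨0, hn⟩⟩
  rw [prob_compl, sub_sub_cancel, uniformFormula, ProbabilityTheory.uniformOn_univ]
  rw [MeasureTheory.Measure.count_apply_finite S S.toFinite, prob, Fintype.expect_eq_sum_div_card,
    ENNReal.ofReal_div_of_pos (Nat.cast_pos.2 Fintype.card_pos), ENNReal.ofReal_natCast]
  congr 1
  rw [← Finset.sum_filter_add_sum_filter_not Finset.univ (· ∈ S)]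
  rw [Finset.sum_congr rfl (g := fun _ => (1 : ℝ)) (fun a ha => by simp [(Finset.mem_filter.1 ha).2]),
    Finset.sum_congr rfl (g := fun _ => (0 : ℝ))
      (s₁ := Finset.univ.filter (· ∉ S)) (fun a ha => by simp [(Finset.mem_filter.1 ha).2])]
  simp only [Finset.sum_const, nsmul_eq_mul, mul_one, mul_zero, add_zero, ENNReal.ofReal_natCast]
  congr 2
  ext a
  simp

theorem tendsto_uniformFormula_one {k : ℕ} {m : ℕ → ℕ} {S : ∀ n, Set (Formula k n (m n))}
    {b : ℕ → ℝ} (hb : Tendsto b atTop (𝓝 0)) (h : ∀ᶠ n in atTop, prob (S n)ᶜ ≤ b n) :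
    Tendsto (fun n => uniformFormula k n (m n) (S n)) atTop (𝓝 1) := by
  have h0 : Tendsto (fun n => prob (S n)ᶜ) atTop (𝓝 0) :=
    tendsto_of_tendsto_of_tendsto_of_le_of_le' tendsto_const_nhds hb
      (Eventually.of_forall fun n => prob_nonneg _) h
  have h1 := ENNReal.tendsto_ofReal (h0.const_sub 1)
  rw [sub_zero, ENNReal.ofReal_one] at h1
  refine h1.congr' ?_
  filter_upwards [eventually_gt_atTop 0] with n hn
  exact (uniformFormula_compl hn _).symm

end Measure

/-! ### The limit in `n`, reduced to four inequalities between constants. -/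

section Limit

theorem tendsto_exp_natCast_mul {c : ℝ} (hc : c < 0) :
    Tendsto (fun n : ℕ => Real.exp (n * c)) atTop (𝓝 0) :=
  Real.tendsto_exp_atBot.comp ((tendsto_natCast_atTop_atTop).atTop_mul_const_of_neg hc)

theorem tendsto_natCast_mul_exp_sub_sqrt (A : ℝ) :
    Tendsto (fun n : ℕ => n * Real.exp (A - √n)) atTop (𝓝 0) := by
  have h := ((Real.tendsto_pow_mul_exp_neg_atTop_nhds_zero 2).comp
    (Real.tendsto_sqrt_atTop.comp (tendsto_natCast_atTop_atTop (R := ℝ)))).const_mul (Real.exp A)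
  rw [mul_zero] at h
  refine h.congr fun n => ?_
  simp only [Function.comp, Real.sq_sqrt (Nat.cast_nonneg n)]
  rw [sub_eq_add_neg, Real.exp_add]
  ring

theorem tendsto_exp_sqrt_mul {c : ℝ} (hc : c < 0) :
    Tendsto (fun n : ℕ => Real.exp (√n * c)) atTop (𝓝 0) :=
  Real.tendsto_exp_atBot.comp
    ((Real.tendsto_sqrt_atTop.comp tendsto_natCast_atTop_atTop).atTop_mul_const_of_neg hc)

/-- From `log(1 - p) ≥ -p/(1 - p)`; the hypothesis `hp₁` says exactly that replacing `w` by `w/(1 -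
p)` costs at most `1`. -/
theorem exp_neg_le_one_sub_pow {p w : ℝ} {m : ℕ} (hp₁ : p * (w + 1) ≤ 1)
    (hw : 0 < w) (hm : m * p ≤ w) : Real.exp (-(w + 1)) ≤ (1 - p) ^ m := by
  have hp : p < 1 := by nlinarith
  have h1 : -(p / (1 - p)) ≤ Real.log (1 - p) := by
    have := Real.one_sub_inv_le_log_of_pos (show 0 < 1 - p by linarith)
    refine le_trans (le_of_eq ?_) this
    field_simp [show (1 - p) ≠ 0 by linarith]
    ring
  have h2 : m * (p / (1 - p)) ≤ w + 1 := by
    rw [← mul_div_assoc, div_le_iff₀ (by linarith)]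
    linarith
  calc Real.exp (-(w + 1)) ≤ Real.exp (m * Real.log (1 - p)) := by
        refine Real.exp_le_exp.2 ?_
        have := mul_le_mul_of_nonneg_left h1 (Nat.cast_nonneg (α := ℝ) m)
        linarith
    _ = (1 - p) ^ m := by rw [Real.exp_nat_mul, Real.exp_log (by linarith)]

theorem tendsto_uniformFormula_phase1 {k : ℕ} (hk : 0 < k) {m : ℕ → ℕ} {w K δ σ l τ : ℝ}
    (hm : ∀ n, (m n : ℝ) ≤ w * 2 ^ k * (k : ℝ)⁻¹ * n) (hw : 0 < w) (hK : 0 ≤ K) (hδ : 0 < δ)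
    (hl : 0 ≤ l) (hτ₀ : 0 ≤ τ) (hτ₁ : τ ≤ 1)
    (hunique : (k : ℝ)⁻¹ + τ * Real.log k + (w * (Real.exp l - 1) - l * K) < 0)
    (hsafe : (k : ℝ)⁻¹ + τ * Real.log k + (σ - Real.exp (-(w + 1)) * (1 - τ) / 2) < 0)
    (hsize : 4 * w * (k : ℝ)⁻¹ * Real.exp (1 - k * τ / 2) - τ / 2 < 0)
    (hkill : 2 * w * (k : ℝ)⁻¹ * Real.exp (-((k₁ k - 1 : ℕ) * σ)) * (2 * K) - δ / 2 < 0) :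
    Tendsto (fun n : ℕ => uniformFormula k n (m n)
      {Φ | ((phase1 Φ).card : ℝ) ≤ n * τ ∧ (numZUnique Φ (phase1 Φ) : ℝ) ≤ K * n ∧
        (numUnsat Φ (sigma (phase1 Φ)) : ℝ) ≤ δ * n}) atTop (𝓝 1) := by
  have hk' : (0 : ℝ) < k := Nat.cast_pos.2 hk
  have hk1 : (1 : ℝ) ≤ k := Nat.one_le_cast.2 hk
  have he : Real.exp 1 - 1 - 2 < 0 := by linarith [Real.exp_one_lt_d9]
  have he' : 0 ≤ Real.exp 1 - 1 := by linarith [Real.add_one_le_exp (1 : ℝ)]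
  have hlog : Real.log (k : ℝ)⁻¹ = -Real.log k := Real.log_inv _
  have hy₁ : (k : ℝ)⁻¹ ≤ 1 := inv_le_one_of_one_le₀ hk1
  set c₁ := (k : ℝ)⁻¹ + τ * Real.log k + (w * (Real.exp l - 1) - l * K) with hc₁
  set c₂ := (k : ℝ)⁻¹ + τ * Real.log k + (σ - Real.exp (-(w + 1)) * (1 - τ) / 2) with hc₂
  set c₃ := w * (k : ℝ)⁻¹ * (Real.exp 1 - 1 - 2) with hc₃
  set c₆ := 4 * w * (k : ℝ)⁻¹ * Real.exp (1 - k * τ / 2) - τ / 2 with hc₆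
  set ρ := Real.exp (-((k₁ k - 1 : ℕ) * σ)) with hρ
  set c₇ := 2 * w * (k : ℝ)⁻¹ * ρ * (2 * K) - δ / 2 with hc₇
  set A := w * 2 ^ k / 2 * (Real.exp 1 - 1) with hA
  set B := w * 2 ^ k * k * (Real.exp 1 - 1) with hB
  have hc₃' : c₃ < 0 := mul_neg_of_pos_of_neg (by positivity) he
  have hlim := ((((((((tendsto_exp_natCast_mul hunique).const_mul 2).add
    (tendsto_exp_natCast_mul hsafe)).add ((tendsto_exp_natCast_mul hc₃').const_mul 2)).add
    (tendsto_natCast_mul_exp_sub_sqrt A)).add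
    ((tendsto_exp_natCast_mul (c := -(δ / 2)) (by linarith)).const_mul (Real.exp B))).add
    (tendsto_exp_natCast_mul hsize)).add (tendsto_exp_sqrt_mul hkill))
  simp only [mul_zero, add_zero] at hlim
  refine tendsto_uniformFormula_one hlim ?_
  filter_upwards [eventually_ge_atTop k, eventually_ge_atTop ⌈w + 1⌉₊] with n hnk hnw
  have hn : 0 < n := hk.trans_le hnk
  have hn' : (0 : ℝ) < n := Nat.cast_pos.2 hn
  have hnk' : (k : ℝ) ≤ n := Nat.cast_le.2 hnk
  have hnw' : w + 1 ≤ n := Nat.ceil_le.1 hnw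
  have hmn := hm n
  have hm1 : (m n : ℝ) * (k / 2 ^ k) ≤ w * n := by
    calc _ ≤ w * 2 ^ k * (k : ℝ)⁻¹ * n * (k / 2 ^ k) := by gcongr
      _ = _ := by field_simp
  -- `N` is twice the bound `wn/k` on the mean. `D = √n` exceeds the bounded mean degree, yet leaves
  -- an exponent of order `√n` for the unsatisfied clauses. The tolerance `δn` is split between
  -- mixed clauses and those with a repeated variable.
  have hbad := prob_phase1_bad_le (k := k) (n := n) (m := m n) hn hk (θ := n * τ) (K := K * n)
    (s := σ * n) (N := 2 * w * (k : ℝ)⁻¹ * n) (D := √n) (T := δ / 2 * n) (by positivity)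
    (by positivity) (Real.sqrt_pos.2 hn')
  rw [show δ / 2 * (n : ℝ) + δ / 2 * n = δ * n by ring] at hbad
  refine hbad.trans ?_
  have b₁ : prob (manyUnique k n (m n) (n * τ) (K * n)) ≤ Real.exp (n * c₁) := by
    -- With `y = 1/k` the union over small sets costs `n(1/k + τ ln k)` in the exponent.
    refine (prob_manyUnique_le hn (inv_pos.2 hk') hy₁ hl).trans (Real.exp_le_exp.2 ?_)
    have h1 : 0 ≤ Real.exp l - 1 := by linarith [Real.add_one_le_exp l]
    have h2 := mul_le_mul_of_nonneg_right hm1 h1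
    rw [hlog, hc₁]
    linarith
  have b₂ : prob (fewSafe k n (m n) (n * τ) (σ * n)) ≤ Real.exp (n * c₂) := by
    refine (prob_fewSafe_le hn (inv_pos.2 hk') hy₁).trans (Real.exp_le_exp.2 ?_)
    have h1 : (k / 2 ^ k : ℝ) ≤ 1 := by
      rw [div_le_one (by positivity)]
      exact_mod_cast Nat.lt_two_pow_self.le
    have h2 : Real.exp (-(w + 1)) ≤ (1 - k / 2 ^ k / n : ℝ) ^ m n := by
      refine exp_neg_le_one_sub_pow ?_ hw ?_
      · rw [div_mul_eq_mul_div, div_le_one hn']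
        exact (mul_le_of_le_one_left (by linarith) h1).trans hnw'
      · rw [← mul_div_assoc, div_le_iff₀ hn']
        exact hm1
    have h3 : 0 ≤ n * (1 - τ) := mul_nonneg hn'.le (by linarith)
    have h4 := mul_le_mul_of_nonneg_right h2 h3
    rw [hlog, hc₂]
    linarith
  have b₃ : prob (manyAllNegative k n (m n) (2 * w * (k : ℝ)⁻¹ * n)) ≤ Real.exp (n * c₃) := by
    refine (prob_manyAllNegative_le hn _).trans (Real.exp_le_exp.2 ?_)
    have h1 : (m n : ℝ) * (1 / 2 ^ k) ≤ w * (k : ℝ)⁻¹ * n := by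
      calc _ ≤ w * 2 ^ k * (k : ℝ)⁻¹ * n * (1 / 2 ^ k) := by gcongr
        _ = _ := by field_simp
    have h2 := mul_le_mul_of_nonneg_right h1 he'
    rw [hc₃]
    linarith
  have b₄ : prob (highDegree k n (m n) √n) ≤ n * Real.exp (A - √n) := by
    refine (prob_highDegree_le hn _).trans (mul_le_mul_of_nonneg_left
      (Real.exp_le_exp.2 (sub_le_sub_right (mul_le_mul_of_nonneg_right ?_ he') _)) hn'.le)
    calc _ ≤ w * 2 ^ k * (k : ℝ)⁻¹ * n * (k / 2 / n) := by gcongr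
      _ = _ := by field_simp
  have b₅ : prob (manyRepeated k n (m n) (δ / 2 * n)) ≤
      Real.exp B * Real.exp (n * -(δ / 2)) := by
    rw [← Real.exp_add]
    refine (prob_manyRepeated_le hn _).trans (Real.exp_le_exp.2 ?_)
    have h1 : (m n : ℝ) * (k ^ 2 / n) ≤ w * 2 ^ k * k := by
      calc _ ≤ w * 2 ^ k * (k : ℝ)⁻¹ * n * (k ^ 2 / n) := by gcongr
        _ = _ := by field_simp
    have h2 := mul_le_mul_of_nonneg_right h1 he'
    rw [hB]
    linarith
  have b₆ : Real.exp (2 * w * (k : ℝ)⁻¹ * n * (2 * Real.exp (-(k * (n * τ / 2 - 1) / n))) -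
      n * τ / 2) ≤ Real.exp (n * c₆) := by
    have h1 : Real.exp (-(k * (n * τ / 2 - 1) / n)) ≤ Real.exp (1 - k * τ / 2) := by
      refine Real.exp_le_exp.2 ?_
      have h2 : (k : ℝ) * (n * τ / 2 - 1) / n = k * τ / 2 - k / n := by field_simp
      have h3 : (k : ℝ) / n ≤ 1 := (div_le_one hn').2 hnk'
      linarith
    have h2 := mul_le_mul_of_nonneg_left h1 (by positivity : 0 ≤ 4 * w * (k : ℝ)⁻¹ * n)
    refine Real.exp_le_exp.2 ?_
    rw [hc₆]
    linarith
  have b₇ : Real.exp (2 * w * (k : ℝ)⁻¹ * n * (Real.exp (-((k₁ k - 1 : ℕ) * (σ * n) / n)) *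
      (2 * (√n)⁻¹ * (K * n) / n)) - (√n)⁻¹ * (δ / 2 * n)) ≤ Real.exp (√n * c₇) := by
    refine Real.exp_le_exp.2 (le_of_eq ?_)
    have h1 : ((k₁ k - 1 : ℕ) : ℝ) * (σ * n) / n = (k₁ k - 1 : ℕ) * σ := by field_simp
    have h2 : (√n)⁻¹ * (n : ℝ) = √n := by
      rw [inv_mul_eq_div, Real.div_sqrt]
    have h3 : 2 * (√n)⁻¹ * (K * n) / n = (√n)⁻¹ * (2 * K) := by field_simp
    rw [h1, ← hρ, h3, hc₇]
    linear_combination (2 * w * (k : ℝ)⁻¹ * ρ * (2 * K) - δ / 2) * h2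
  linarith

end Limit

/-! ### Growth comparisons that fix how large `k` must be. -/

section LargeK

theorem eventually_constants {ε : ℝ} (hε₀ : 0 < ε) (hε₁ : ε < 0.1) :
    ∀ᶠ x : ℝ in atTop, 6 ≤ (1 - ε) * Real.log x ∧ 1 + 4 * Real.log x ^ 2 < ε ^ 2 / 36 * x ∧
      1 + 4 * Real.log x ^ 2 + x ^ (ε / 2) < x ^ ε / 12 ∧ 4 * x ^ (ε / 8) < x ^ (ε / 2) := by
  have hpow : ∀ r s : ℝ, r < s → (fun x : ℝ => x ^ r) =o[atTop] fun x => x ^ s := by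
    intro r s h
    refine Asymptotics.isLittleO_of_tendsto' ?_ ?_
    · filter_upwards [eventually_gt_atTop 0] with x hx h0
      exact absurd h0 (Real.rpow_pos_of_pos hx s).ne'
    · refine (tendsto_rpow_neg_atTop (sub_pos.2 h)).congr' ?_
      filter_upwards [eventually_gt_atTop 0] with x hx
      rw [neg_sub, Real.rpow_sub hx]
  have hone : ∀ r : ℝ, 0 < r → (fun _ : ℝ => (1 : ℝ)) =o[atTop] fun x => x ^ r := fun r hr => by
    simpa using hpow 0 r hr
  have hlog : ∀ r : ℝ, 0 < r → (fun x : ℝ => Real.log x ^ 2) =o[atTop] fun x => x ^ r :=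
    fun r hr => by simpa using isLittleO_log_rpow_rpow_atTop 2 hr
  have h2 := ((hone 1 one_pos).add ((hlog 1 one_pos).const_mul_left 4)).bound
    (show 0 < ε ^ 2 / 72 by positivity)
  have h3 := (((hone ε hε₀).add ((hlog ε hε₀).const_mul_left 4)).add
    (hpow (ε / 2) ε (by linarith))).bound (show (0 : ℝ) < 1 / 24 by norm_num)
  have h4 := (hpow (ε / 8) (ε / 2) (by linarith)).bound (show (0 : ℝ) < 1 / 8 by norm_num)
  have h1 : ∀ᶠ x : ℝ in atTop, 6 ≤ (1 - ε) * Real.log x :=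
    (Real.tendsto_log_atTop.const_mul_atTop (by linarith)).eventually_ge_atTop 6
  filter_upwards [h1, h2, h3, h4, eventually_gt_atTop 0] with x h1 h2 h3 h4 hx
  have p1 : 0 < x ^ (ε / 2) := Real.rpow_pos_of_pos hx _
  have p2 : 0 < x ^ ε := Real.rpow_pos_of_pos hx _
  have p3 : 0 < x ^ (ε / 8) := Real.rpow_pos_of_pos hx _
  rw [Real.norm_of_nonneg (by positivity), Real.norm_of_nonneg (by positivity)] at h2 h3 h4
  rw [Real.rpow_one] at h2
  refine ⟨h1, ?_, by linarith, by linarith⟩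
  nlinarith [sq_pos_of_pos hε₀, mul_pos (sq_pos_of_pos hε₀) hx]

end LargeK

end RandomKSAT

open RandomKSAT in
theorem proposition3p1 (ε : ℝ) (hε₀ : 0 < ε) (hε₁ : ε < 0.1) :
    ∃ k₀ : ℕ, ∀ k : ℕ, k₀ ≤ k →
      Tendsto
        (fun n : ℕ =>
          RandomKSAT.uniformFormula k n (RandomKSAT.numClauses ε k n)
            {Φ : RandomKSAT.Formula k n (RandomKSAT.numClauses ε k n) |
              ((RandomKSAT.phase1 Φ).card : ℝ)
                  ≤ 4 * n * (k : ℝ)⁻¹ * Real.log (RandomKSAT.omega ε k) ∧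
              (RandomKSAT.numZUnique Φ (RandomKSAT.phase1 Φ) : ℝ)
                  ≤ (1 + ε / 3) * RandomKSAT.omega ε k * n ∧
              (RandomKSAT.numUnsat Φ (RandomKSAT.sigma (RandomKSAT.phase1 Φ)) : ℝ)
                  ≤ Real.exp (-(k : ℝ) ^ (ε / 8)) * n})
        atTop (𝓝 1) := by
  obtain ⟨k₀, hk₀⟩ := eventually_atTop.1
    (((tendsto_natCast_atTop_atTop (R := ℝ)).eventually (eventually_constants hε₀ hε₁)).and
      (eventually_ge_atTop 4))
  refine ⟨k₀, fun k hk => ?_⟩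
  obtain ⟨⟨h1, h2, h3, h4⟩, hk4⟩ := hk₀ k hk
  have hkpos : 0 < k := by omega
  have hk' : (0 : ℝ) < k := Nat.cast_pos.2 hkpos
  have hinv : 0 < (k : ℝ)⁻¹ := inv_pos.2 hk'
  set w := omega ε k with hw
  have hw' : w = (1 - ε) * Real.log k := rfl
  have hw6 : 6 ≤ w := h1
  have hL6 : 6 ≤ Real.log k := by nlinarith
  have hwL : w ≤ Real.log k := by rw [hw']; nlinarith
  have hlw1 : 1 < Real.log w := by
    rw [Real.lt_log_iff_exp_lt (by linarith)]
    linarith [Real.exp_one_lt_d9]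
  have hlwL : Real.log w ≤ Real.log k := (Real.log_le_self (by linarith)).trans hwL
  set τ := 4 * (k : ℝ)⁻¹ * Real.log w with hτ
  have hA : (k : ℝ)⁻¹ + 4 * (k : ℝ)⁻¹ * Real.log k ^ 2 < ε ^ 2 / 36 := by
    have := mul_lt_mul_of_pos_left h2 hinv
    rw [mul_left_comm, inv_mul_cancel₀ hk'.ne'] at this
    linarith
  have hε2 : ε ^ 2 / 36 < 1 / 2 := by nlinarith
  have hτ₀ : 0 ≤ τ := by positivity
  have hτL : τ * Real.log k ≤ 4 * (k : ℝ)⁻¹ * Real.log k ^ 2 := by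
    have := mul_le_mul_of_nonneg_left hlwL
      (by positivity : 0 ≤ 4 * (k : ℝ)⁻¹ * Real.log k)
    rw [hτ]
    nlinarith
  have hτ2 : τ ≤ 1 / 2 := by nlinarith
  have hkτ : k * τ / 2 = 2 * Real.log w := by
    rw [hτ]; field_simp; ring
  have hm : ∀ n, (numClauses ε k n : ℝ) ≤ w * 2 ^ k * (k : ℝ)⁻¹ * n := by
    intro n
    have h0 : 0 ≤ (1 - ε) * 2 ^ k * (k : ℝ)⁻¹ * Real.log k * n := by
      have : 0 ≤ 1 - ε := by linarith
      positivity
    refine (Nat.floor_le h0).trans (le_of_eq ?_)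
    rw [hw']; ring
  -- `l = ε/6` makes the Chernoff exponent at most `-wε²/36`. The value of `σ` is below the typical
  -- safe density, of order `e^(-w) = k^(-1+ε)`, but large enough that `kσ = k^(ε/2)` beats
  -- `k^(ε/8)`.
  have key := tendsto_uniformFormula_phase1 hkpos (w := w) (K := (1 + ε / 3) * w)
    (δ := Real.exp (-(k : ℝ) ^ (ε / 8))) (σ := (k : ℝ) ^ (-1 + ε / 2)) (l := ε / 6) (τ := τ) hm
    (by linarith) (by positivity) (Real.exp_pos _) (by positivity) hτ₀ (by linarith)
    ?_ ?_ ?_ ?_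
  · have e : ∀ n : ℕ, 4 * n * (k : ℝ)⁻¹ * Real.log w = n * τ := fun n => by rw [hτ]; ring
    simpa only [e] using key
  · have h5 := Real.abs_exp_sub_one_sub_id_le (x := ε / 6)
      (by rw [abs_of_nonneg (by positivity)]; linarith)
    have h6 := (abs_le.1 h5).2
    have h7 := mul_le_mul_of_nonneg_left h6 (show 0 ≤ w by linarith)
    have h8 : ε ^ 2 / 36 * 1 ≤ ε ^ 2 / 36 * w :=
      mul_le_mul_of_nonneg_left (by linarith) (by positivity)
    nlinarith
  · have h5 : Real.exp (-w) = (k : ℝ)⁻¹ * (k : ℝ) ^ ε := by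
      rw [← Real.rpow_neg_one, ← Real.rpow_add hk', Real.rpow_def_of_pos hk', hw']
      ring_nf
    have h6 : (k : ℝ) ^ (-1 + ε / 2) = (k : ℝ)⁻¹ * (k : ℝ) ^ (ε / 2) := by
      rw [Real.rpow_add hk', Real.rpow_neg_one]
    have h7 : (k : ℝ)⁻¹ * (k : ℝ) ^ ε / 3 ≤ Real.exp (-(w + 1)) := by
      rw [neg_add, Real.exp_add, h5, div_eq_mul_inv]
      refine mul_le_mul_of_nonneg_left ?_ (by positivity)
      rw [Real.exp_neg]
      exact inv_anti₀ (Real.exp_pos _) (by linarith [Real.exp_one_lt_d9])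
    have h8 := mul_lt_mul_of_pos_left h3 hinv
    -- The losses `1/3` from `e⁻¹`, `1/2` from `1 - τ` and `1/2` from the occupancy bound make up
    -- the `1/12` in `eventually_constants`.
    have h9 : (k : ℝ)⁻¹ * (k : ℝ) ^ ε / 3 * (1 / 2) ≤ Real.exp (-(w + 1)) * (1 - τ) :=
      mul_le_mul h7 (by linarith) (by norm_num) (Real.exp_pos _).le
    rw [h6]
    linarith
  -- Here `τ` is tuned so that `exp(-kτ/2) = w⁻²`; what remains is `2e < w ln w`, true for `w ≥ 6`.
  · have h5 : Real.exp (1 - k * τ / 2) = Real.exp 1 / w ^ 2 := by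
      rw [hkτ, Real.exp_sub, ← Real.exp_log (show 0 < w by linarith), ← Real.exp_nat_mul,
        Real.log_exp]
      norm_num
    have h6 : 4 * w * (k : ℝ)⁻¹ * (Real.exp 1 / w ^ 2) = (k : ℝ)⁻¹ * (4 * Real.exp 1 / w) := by
      have : w ≠ 0 := by linarith
      field_simp
    have h7 : 4 * Real.exp 1 / w < 2 * Real.log w := by
      rw [div_lt_iff₀ (by linarith)]
      nlinarith [Real.exp_one_lt_d9]
    have h8 := mul_lt_mul_of_pos_left h7 hinv
    rw [h5, h6, hτ]
    linarith
  · have h5 : (k : ℝ) / 4 ≤ (k₁ k - 1 : ℕ) := by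
      -- This is where `k ≥ 4` enters: for `k = 2` no position precedes `k₁`.
      have : k ≤ 4 * (k₁ k - 1) := by unfold k₁; omega
      have : (k : ℝ) ≤ 4 * (k₁ k - 1 : ℕ) := by exact_mod_cast this
      linarith
    have h6 : (k : ℝ) ^ (ε / 8) < (k₁ k - 1 : ℕ) * (k : ℝ) ^ (-1 + ε / 2) := by
      have h7 : (k : ℝ) / 4 * (k : ℝ) ^ (-1 + ε / 2) = (k : ℝ) ^ (ε / 2) / 4 := by
        rw [Real.rpow_add hk', Real.rpow_neg_one]; field_simp
      have h8 := mul_le_mul_of_nonneg_right h5 (Real.rpow_pos_of_pos hk' (-1 + ε / 2)).le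
      linarith
    have h7 := Real.exp_lt_exp.2 (neg_lt_neg h6)
    set ρ := Real.exp (-((k₁ k - 1 : ℕ) * (k : ℝ) ^ (-1 + ε / 2)))
    have hρ : 0 < ρ := Real.exp_pos _
    have h8 : 2 * w * (k : ℝ)⁻¹ * (2 * ((1 + ε / 3) * w)) ≤ 1 / 2 := by
      have h9 : w ^ 2 ≤ Real.log k ^ 2 := pow_le_pow_left₀ (by linarith) hwL 2
      have h10 := mul_le_mul_of_nonneg_left h9 hinv.le
      have h11 : ε * ((k : ℝ)⁻¹ * w ^ 2) ≤ 1 * ((k : ℝ)⁻¹ * w ^ 2) :=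
        mul_le_mul_of_nonneg_right (by linarith) (by positivity)
      nlinarith
    nlinarith [mul_le_mul_of_nonneg_right h8 hρ.le]
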